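/- **Setting.** Let $s\ge 1$ and let $\bar M$ be a smooth manifold of dimension $2n+s$ with a Riemannian metric $g$, a $(1,1)$-tensor field $\varphi$, vector fields $\xi_1,\dots,\xi_s$ and $1$-forms $\eta^1,\dots,\eta^s$ (all smooth) such that, for all vector fields $X,Y$ and all $i,j$, $$\varphi^2=-I+\sum_{i=1}^s\eta^i\otimes\xi_i,\quad \eta^i(\xi_j)=\delta_{ij},\quad g(\varphi X,\varphi Y)=g(X,Y)-\sum_{i=1}^s\eta^i(X)\eta^i(Y),$$ $$\eta^i(X)=g(X,\xi_i),\quad g(X,\varphi Y)=-g(\varphi X,Y),\quad \varphi\xi_i=0,\quad \eta^i\circ\varphi=0 .$$ Put $\Phi(X,Y)=g(X,\varphi Y)$. Then $\bar M$ is called a *generalized Kenmotsu manifold* if $\eta^1\wedge\dots\wedge\eta^s\wedge\Phi^n$ vanishes nowhere, every $\eta^i$ is closed, $d\Phi=2\sum_{i=1}^s\eta^i\wedge\Phi$, and $[\varphi,\varphi]+2\sum_{i=1}^s d\eta^i\otimes\xi_i=0$, where $[\varphi,\varphi]$ is the Nijenhuis tensor of $\varphi$. Let $M$ be a (possibly only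 immersed) submanifold of $\bar M$ with the induced metric. It is *invariant* if $\varphi(T_xM)\subseteq T_xM$ for every $x\in M$ and all $\xi_i$ are tangent to $M$. Let $\nabla$ be the Levi-Civita connection of $M$ with curvature $R$, $h$ the second fundamental form of $M$ in $\bar M$, and $\nabla^\perp$ the normal connection with curvature $R^\perp$. For vector fields $X,Y,Z,U,V$ tangent to $M$ put $$(\bar\nabla h)(Z,U,V)=\nabla^\perp_Z\big(h(U,V)\big)-h(\nabla_ZU,V)-h(U,\nabla_ZV),$$ $$(\bar R(X,Y)\cdot\bar\nabla h)(Z,U,V)=R^\perp(X,Y)\big((\bar\nabla h)(Z,U,V)\big)-(\bar\nabla h)(R(X,Y)Z,U,V)-(\bar\nabla h)(Z,R(X,Y)U,V)-(\bar\nabla h)(Z,U,R(X,Y)V).$$ $M$ is *2-semiparallel* if $\bar R(X,Y)\cdot\bar\nabla h=0$ for all vector fields $X,Y$ tangent to $M$, and *totally geodesic* if $h=0$. **Theorem.** Let $M$ be an invariant submanifold of a generalized Kenmotsu manifold $\bar M$. Then $M$ is 2-semiparallel if and only if $M$ is totally geodesic. -/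

import Mathlib

open Bundle VectorField
open scoped Manifold ContDiff Topology

noncomputable section

namespace GenKenmotsu

/-! ### Levi-Civita connection and curvature -/

section Riemannian

variable {E : Type*} [NormedAddCommGroup E] [NormedSpace ℝ E] [FiniteDimensional ℝ E]
  {M : Type*} [TopologicalSpace M] [ChartedSpace E M] [IsManifold 𝓘(ℝ, E) ∞ M]

instance tangentFiniteDimensional (x : M) :
    FiniteDimensional ℝ (TangentSpace 𝓘(ℝ, E) x) :=
  inferInstanceAs (FiniteDimensional ℝ E)

/-- `X` is a (globally defined) smooth vector field. -/
def IsSmoothVF (X : Π x : M, TangentSpace 𝓘(ℝ, E) x) : Prop :=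
  ContMDiff 𝓘(ℝ, E) (𝓘(ℝ, E).prod 𝓘(ℝ, E)) ∞
    (fun x ↦ (⟨x, X x⟩ : TotalSpace E (TangentSpace 𝓘(ℝ, E) : M → Type _)))

/-- The derivative `X(u)` of a function `u` along a vector field `X`. -/
def dirDeriv (X : Π x : M, TangentSpace 𝓘(ℝ, E) x) (u : M → ℝ) (x : M) : ℝ :=
  mvfderiv 𝓘(ℝ, E) u x (X x)

variable [RiemannianBundle (fun x : M ↦ TangentSpace 𝓘(ℝ, E) x)]

/-- The right-hand side of the Koszul formula, so that `g(∇_X Y, Z) = koszul X Y Z`. -/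
def koszul (X Y Z : Π x : M, TangentSpace 𝓘(ℝ, E) x) (x : M) : ℝ :=
  (1 / 2) * (dirDeriv X (fun y ↦ inner ℝ (Y y) (Z y)) x
    + dirDeriv Y (fun y ↦ inner ℝ (X y) (Z y)) x
    - dirDeriv Z (fun y ↦ inner ℝ (X y) (Y y)) x
    + inner ℝ (mlieBracket 𝓘(ℝ, E) X Y x) (Z x)
    - inner ℝ (mlieBracket 𝓘(ℝ, E) X Z x) (Y x)
    - inner ℝ (mlieBracket 𝓘(ℝ, E) Y Z x) (X x))

/-- The Levi-Civita connection `∇_X Y`: at `x` it is the tangent vector which the metric pairs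
with every `z` to the value of the Koszul formula, written out in an orthonormal basis of `T_x M`
(each basis vector being extended to a local vector field). -/
def leviCivita (X Y : Π x : M, TangentSpace 𝓘(ℝ, E) x) (x : M) : TangentSpace 𝓘(ℝ, E) x :=
  ∑ a, koszul X Y
      (FiberBundle.extend E (stdOrthonormalBasis ℝ (TangentSpace 𝓘(ℝ, E) x) a)) x •
    stdOrthonormalBasis ℝ (TangentSpace 𝓘(ℝ, E) x) a

/-- The curvature `R(X,Y)Z = ∇_X ∇_Y Z - ∇_Y ∇_X Z - ∇_[X,Y] Z`. -/
def curvature (X Y Z : Π x : M, TangentSpace 𝓘(ℝ, E) x) (x : M) : TangentSpace 𝓘(ℝ, E) x :=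
  leviCivita X (leviCivita Y Z) x - leviCivita Y (leviCivita X Z) x
    - leviCivita (mlieBracket 𝓘(ℝ, E) X Y) Z x

end Riemannian

/-! ### Generalized Kenmotsu structures -/

section Kenmotsu

variable {E : Type*} [NormedAddCommGroup E] [NormedSpace ℝ E] [FiniteDimensional ℝ E]
  {M : Type*} [TopologicalSpace M] [ChartedSpace E M] [IsManifold 𝓘(ℝ, E) ∞ M]

/-- Exterior derivative of a 1-form on vector fields:
`2 dη(X,Y) = X η(Y) - Y η(X) - η([X,Y])`. -/
def extDerivOne (η : Π x : M, TangentSpace 𝓘(ℝ, E) x →L[ℝ] ℝ)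
    (X Y : Π x : M, TangentSpace 𝓘(ℝ, E) x) (x : M) : ℝ :=
  (1 / 2) * (dirDeriv X (fun y ↦ η y (Y y)) x - dirDeriv Y (fun y ↦ η y (X y)) x
    - η x (mlieBracket 𝓘(ℝ, E) X Y x))

/-- Exterior derivative of a 2-form on vector fields, in the normalization of `extDerivOne`:
`3 dΦ(X,Y,Z)` is the cyclic sum of `X Φ(Y,Z) - Φ([X,Y],Z)`. -/
def extDerivTwo (Φ : Π x : M, TangentSpace 𝓘(ℝ, E) x → TangentSpace 𝓘(ℝ, E) x → ℝ)
    (X Y Z : Π x : M, TangentSpace 𝓘(ℝ, E) x) (x : M) : ℝ :=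
  (1 / 3) * (dirDeriv X (fun y ↦ Φ y (Y y) (Z y)) x + dirDeriv Y (fun y ↦ Φ y (Z y) (X y)) x
    + dirDeriv Z (fun y ↦ Φ y (X y) (Y y)) x
    - Φ x (mlieBracket 𝓘(ℝ, E) X Y x) (Z x) - Φ x (mlieBracket 𝓘(ℝ, E) Y Z x) (X x)
    - Φ x (mlieBracket 𝓘(ℝ, E) Z X x) (Y x))

/-- The wedge product of a 1-form and a 2-form, in the same normalization (the factor `1/3`
occurs in `extDerivTwo` too, so the equation `dΦ = 2 ∑ ηⁱ ∧ Φ` does not depend on it). -/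
def wedgeOneTwo (η : Π x : M, TangentSpace 𝓘(ℝ, E) x →L[ℝ] ℝ)
    (Φ : Π x : M, TangentSpace 𝓘(ℝ, E) x → TangentSpace 𝓘(ℝ, E) x → ℝ)
    (X Y Z : Π x : M, TangentSpace 𝓘(ℝ, E) x) (x : M) : ℝ :=
  (1 / 3) * (η x (X x) * Φ x (Y x) (Z x) + η x (Y x) * Φ x (Z x) (X x)
    + η x (Z x) * Φ x (X x) (Y x))

/-- The Nijenhuis tensor
`[φ,φ](X,Y) = φ²[X,Y] + [φX,φY] - φ[φX,Y] - φ[X,φY]`. -/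
def nijenhuis (φ : Π x : M, TangentSpace 𝓘(ℝ, E) x →L[ℝ] TangentSpace 𝓘(ℝ, E) x)
    (X Y : Π x : M, TangentSpace 𝓘(ℝ, E) x) (x : M) : TangentSpace 𝓘(ℝ, E) x :=
  φ x (φ x (mlieBracket 𝓘(ℝ, E) X Y x))
    + mlieBracket 𝓘(ℝ, E) (fun y ↦ φ y (X y)) (fun y ↦ φ y (Y y)) x
    - φ x (mlieBracket 𝓘(ℝ, E) (fun y ↦ φ y (X y)) Y x)
    - φ x (mlieBracket 𝓘(ℝ, E) X (fun y ↦ φ y (Y y)) x)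

/-- A metric `f`-structure `(φ, ξ_i, ηⁱ, g)` with `s` structure vector fields on a manifold with
Riemannian metric `g`. -/
structure MetricFStructure (E M : Type*) [NormedAddCommGroup E] [NormedSpace ℝ E]
    [FiniteDimensional ℝ E] [TopologicalSpace M] [ChartedSpace E M] [IsManifold 𝓘(ℝ, E) ∞ M]
    [RiemannianBundle (fun x : M ↦ TangentSpace 𝓘(ℝ, E) x)] (s : ℕ) where
  /-- the tensor field of type `(1,1)` -/
  φ : Π x : M, TangentSpace 𝓘(ℝ, E) x →L[ℝ] TangentSpace 𝓘(ℝ, E) x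
  /-- the structure vector fields -/
  ξ : Fin s → Π x : M, TangentSpace 𝓘(ℝ, E) x
  /-- the structure 1-forms -/
  η : Fin s → Π x : M, TangentSpace 𝓘(ℝ, E) x →L[ℝ] ℝ
  smooth_φ : ContMDiff 𝓘(ℝ, E) (𝓘(ℝ, E).prod 𝓘(ℝ, E →L[ℝ] E)) ∞
    (fun x ↦ TotalSpace.mk' (E →L[ℝ] E)
      (E := fun x : M ↦ TangentSpace 𝓘(ℝ, E) x →L[ℝ] TangentSpace 𝓘(ℝ, E) x) x (φ x))
  smooth_ξ : ∀ i, IsSmoothVF (ξ i)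
  smooth_η : ∀ i, ContMDiff 𝓘(ℝ, E) (𝓘(ℝ, E).prod 𝓘(ℝ, E →L[ℝ] ℝ)) ∞
    (fun x ↦ TotalSpace.mk' (E →L[ℝ] ℝ)
      (E := fun x : M ↦ TangentSpace 𝓘(ℝ, E) x →L[ℝ] Bundle.Trivial M ℝ x) x (η i x))
  φ_φ : ∀ x v, φ x (φ x v) = -v + ∑ i, η i x v • ξ i x
  η_ξ : ∀ i j x, η i x (ξ j x) = if i = j then 1 else 0
  inner_φ_φ : ∀ x v w, inner ℝ (φ x v) (φ x w) = inner ℝ v w - ∑ i, η i x v * η i x w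
  η_eq : ∀ i x v, η i x v = inner ℝ v (ξ i x)
  skew : ∀ x v w, inner ℝ v (φ x w) = -inner ℝ (φ x v) w
  φ_ξ : ∀ i x, φ x (ξ i x) = 0
  η_φ : ∀ i x v, η i x (φ x v) = 0

namespace MetricFStructure

variable [RiemannianBundle (fun x : M ↦ TangentSpace 𝓘(ℝ, E) x)] {s : ℕ}
  (S : MetricFStructure E M s)

/-- The fundamental 2-form `Φ(X,Y) = g(X, φY)`. -/
def Φ (x : M) (v w : TangentSpace 𝓘(ℝ, E) x) : ℝ := inner ℝ v (S.φ x w)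

/-- `η¹ ∧ … ∧ ηˢ ∧ Φⁿ` evaluated on `2n + s` tangent vectors, up to a nonzero constant factor. -/
def volForm (n : ℕ) (x : M) (v : Fin s ⊕ Fin n × Fin 2 → TangentSpace 𝓘(ℝ, E) x) : ℝ :=
  ∑ σ : Equiv.Perm (Fin s ⊕ Fin n × Fin 2), ((Equiv.Perm.sign σ : ℤ) : ℝ) *
    ((∏ i : Fin s, S.η i x (v (σ (Sum.inl i)))) *
      ∏ k : Fin n, S.Φ x (v (σ (Sum.inr (k, 0)))) (v (σ (Sum.inr (k, 1)))))

/-- Almost `s`-contact metric structure in dimension `2n + s`: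
`η¹ ∧ … ∧ ηˢ ∧ Φⁿ` vanishes nowhere. -/
def IsAlmostSContact (n : ℕ) : Prop :=
  Module.finrank ℝ E = 2 * n + s ∧ ∀ x : M, ∃ v, S.volForm n x v ≠ 0

/-- Normality: `[φ,φ] + 2 ∑ dηⁱ ⊗ ξ_i = 0`. -/
def IsNormal : Prop :=
  ∀ X Y : Π x : M, TangentSpace 𝓘(ℝ, E) x, IsSmoothVF X → IsSmoothVF Y →
    ∀ x, nijenhuis S.φ X Y x + (2 : ℝ) • ∑ i, extDerivOne (S.η i) X Y x • S.ξ i x = 0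

/-- Generalized almost Kenmotsu structure in dimension `2n + s`: `s ≥ 1`, the `ηⁱ` are closed and
`dΦ = 2 ∑ ηⁱ ∧ Φ`. -/
structure IsGeneralizedAlmostKenmotsu (n : ℕ) : Prop where
  one_le : 1 ≤ s
  almostSContact : S.IsAlmostSContact n
  closed : ∀ i, ∀ X Y : Π x : M, TangentSpace 𝓘(ℝ, E) x, IsSmoothVF X → IsSmoothVF Y →
    ∀ x, extDerivOne (S.η i) X Y x = 0
  dΦ : ∀ X Y Z : Π x : M, TangentSpace 𝓘(ℝ, E) x,
    IsSmoothVF X → IsSmoothVF Y → IsSmoothVF Z →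
    ∀ x, extDerivTwo S.Φ X Y Z x = 2 * ∑ i, wedgeOneTwo (S.η i) S.Φ X Y Z x

/-- Generalized Kenmotsu structure: a normal generalized almost Kenmotsu structure. -/
structure IsGeneralizedKenmotsu (n : ℕ) : Prop extends S.IsGeneralizedAlmostKenmotsu n where
  normal : S.IsNormal

end MetricFStructure

end Kenmotsu

/-! ### Submanifolds -/

section Submanifold

variable {E F : Type*} [NormedAddCommGroup E] [NormedSpace ℝ E] [FiniteDimensional ℝ E]
  [NormedAddCommGroup F] [NormedSpace ℝ F] [FiniteDimensional ℝ F]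
  {M : Type*} [TopologicalSpace M] [ChartedSpace E M] [IsManifold 𝓘(ℝ, E) ∞ M]
  [RiemannianBundle (fun x : M ↦ TangentSpace 𝓘(ℝ, E) x)]
  {N : Type*} [TopologicalSpace N] [ChartedSpace F N] [IsManifold 𝓘(ℝ, F) ∞ N]
  [RiemannianBundle (fun x : N ↦ TangentSpace 𝓘(ℝ, F) x)]

variable (E F) in
/-- `f : M → N` is an isometric immersion, i.e. `M` is an (immersed) submanifold of `N` and
carries the induced metric. -/
structure IsIsometricImmersion (f : M → N) : Prop where
  smooth : ContMDiff 𝓘(ℝ, E) 𝓘(ℝ, F) ∞ f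
  immersion : ∀ x, Function.Injective (mfderiv 𝓘(ℝ, E) 𝓘(ℝ, F) f x)
  isometric : ∀ x (v w : TangentSpace 𝓘(ℝ, E) x),
    inner ℝ (mfderiv 𝓘(ℝ, E) 𝓘(ℝ, F) f x v) (mfderiv 𝓘(ℝ, E) 𝓘(ℝ, F) f x w) = inner ℝ v w

/-- The image `df(T_x M)` of the tangent space inside `T_{f(x)} N`. -/
def tangentImage (f : M → N) (x : M) : Submodule ℝ (TangentSpace 𝓘(ℝ, F) (f x)) :=
  LinearMap.range (mfderiv 𝓘(ℝ, E) 𝓘(ℝ, F) f x).toLinearMap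

/-- Orthogonal projection of `T_{f(x)} N` onto the normal space of `M` at `x`. -/
def normalPart (f : M → N) (x : M) (v : TangentSpace 𝓘(ℝ, F) (f x)) :
    TangentSpace 𝓘(ℝ, F) (f x) :=
  (tangentImage (E := E) f x)ᗮ.starProjection v

/-- The Levi-Civita connection `∇̄_X V` of `N` acting on vector fields `V` along `f`
(the pull-back connection). In the trivialization of `TN` at `f(x)`, the first term differentiates
the components of `V`; the second differentiates the local frame, since `FiberBundle.extend` is the
extension with constant components in that trivialization. -/
def covAlong (f : M → N) (X : Π x : M, TangentSpace 𝓘(ℝ, E) x)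
    (V : Π x : M, TangentSpace 𝓘(ℝ, F) (f x)) (x : M) : TangentSpace 𝓘(ℝ, F) (f x) :=
  (trivializationAt F (TangentSpace 𝓘(ℝ, F) : N → Type _) (f x)).symm (f x)
      (mvfderiv 𝓘(ℝ, E)
        (fun y ↦ (trivializationAt F (TangentSpace 𝓘(ℝ, F) : N → Type _) (f x)
          ⟨f y, V y⟩).2) x (X x))
    + leviCivita (FiberBundle.extend F (mfderiv 𝓘(ℝ, E) 𝓘(ℝ, F) f x (X x)))
        (FiberBundle.extend F (V x)) (f x)

/-- The second fundamental form `h(X,Y)`: the normal part of `∇̄_X Y`. -/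
def secondFundamentalForm (f : M → N) (X Y : Π x : M, TangentSpace 𝓘(ℝ, E) x) (x : M) :
    TangentSpace 𝓘(ℝ, F) (f x) :=
  normalPart (E := E) f x (covAlong f X (fun y ↦ mfderiv 𝓘(ℝ, E) 𝓘(ℝ, F) f y (Y y)) x)

/-- The normal connection `∇^⊥_X V`: the normal part of `∇̄_X V`. -/
def normalConnection (f : M → N) (X : Π x : M, TangentSpace 𝓘(ℝ, E) x)
    (V : Π x : M, TangentSpace 𝓘(ℝ, F) (f x)) (x : M) : TangentSpace 𝓘(ℝ, F) (f x) :=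
  normalPart (E := E) f x (covAlong f X V x)

/-- The normal curvature `R^⊥(X,Y)V`. -/
def normalCurvature (f : M → N) (X Y : Π x : M, TangentSpace 𝓘(ℝ, E) x)
    (V : Π x : M, TangentSpace 𝓘(ℝ, F) (f x)) (x : M) : TangentSpace 𝓘(ℝ, F) (f x) :=
  normalConnection f X (normalConnection f Y V) x
    - normalConnection f Y (normalConnection f X V) x
    - normalConnection f (mlieBracket 𝓘(ℝ, E) X Y) V x

/-- The van der Waerden-Bortolotti derivative
`(∇̄h)(Z,U,V) = (∇̄_Z h)(U,V) = ∇^⊥_Z (h(U,V)) - h(∇_Z U, V) - h(U, ∇_Z V)`. -/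
def covSecondFundamentalForm (f : M → N) (Z U V : Π x : M, TangentSpace 𝓘(ℝ, E) x) (x : M) :
    TangentSpace 𝓘(ℝ, F) (f x) :=
  normalConnection f Z (secondFundamentalForm f U V) x
    - secondFundamentalForm f (leviCivita Z U) V x
    - secondFundamentalForm f U (leviCivita Z V) x

/-- `(R̄(X,Y)·∇̄h)(Z,U,V)`, where `R̄` is the curvature of the van der Waerden-Bortolotti connection:
`R^⊥(X,Y)((∇̄h)(Z,U,V)) - (∇̄h)(R(X,Y)Z,U,V) - (∇̄h)(Z,R(X,Y)U,V) - (∇̄h)(Z,U,R(X,Y)V)`. -/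
def curvatureActionOnCovSFF (f : M → N) (X Y Z U V : Π x : M, TangentSpace 𝓘(ℝ, E) x) (x : M) :
    TangentSpace 𝓘(ℝ, F) (f x) :=
  normalCurvature f X Y (covSecondFundamentalForm f Z U V) x
    - covSecondFundamentalForm f (curvature X Y Z) U V x
    - covSecondFundamentalForm f Z (curvature X Y U) V x
    - covSecondFundamentalForm f Z U (curvature X Y V) x

variable (E F) in
/-- `M` is 2-semiparallel: `R̄(X,Y)·∇̄h = 0` for all vector fields `X, Y` tangent to `M`. -/
def IsTwoSemiparallel (f : M → N) : Prop :=
  ∀ X Y Z U V : Π x : M, TangentSpace 𝓘(ℝ, E) x,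
    IsSmoothVF X → IsSmoothVF Y → IsSmoothVF Z → IsSmoothVF U → IsSmoothVF V →
    ∀ x, curvatureActionOnCovSFF (F := F) f X Y Z U V x = 0

variable (E F) in
/-- `M` is totally geodesic: `h = 0`. -/
def IsTotallyGeodesic (f : M → N) : Prop :=
  ∀ X Y : Π x : M, TangentSpace 𝓘(ℝ, E) x, IsSmoothVF X → IsSmoothVF Y →
    ∀ x, secondFundamentalForm (F := F) f X Y x = 0

variable (E) in
/-- `M` is an invariant submanifold: `φ(T_x M) ⊆ T_x M` and all `ξ_i` are tangent to `M`. -/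
structure IsInvariantSubmanifold {s : ℕ} (S : MetricFStructure F N s) (f : M → N) : Prop
    extends IsIsometricImmersion E F f where
  φ_mem : ∀ x, ∀ v ∈ tangentImage (E := E) f x, S.φ (f x) v ∈ tangentImage (E := E) f x
  ξ_mem : ∀ i x, S.ξ i (f x) ∈ tangentImage (E := E) f x

end Submanifold

end GenKenmotsu

end

noncomputable section

/-! Everything rests on the behaviour of the structure fields. Closedness of the `η k` makes them
invariant under the flow of `ξ i`; with normality, `φ` is invariant too; and `dΦ = 2 ∑ η ∧ Φ` gives
`L_ξ Φ = 2Φ`. Since `φ` and `Φ` determine `g` up to the `η k`, this yields `L_ξ g = 2(g - ∑ η ⊗ η)`.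
The Koszul formula then gives `∇̄_X ξ_i = X - ∑ η^k(X) ξ_k`, i.e. `∇̄_X ξ_i = PX` with `P` the
projection orthogonal to all the `ξ k` (`MetricFStructure.leviCivita_ξ`).

On the submanifold the `ξ k` are tangent, so `∇̄_X ξ_i = PX` is tangent as well. Splitting it gives
`h(X, ξ_i) = 0` and `∇_X ξ_i = PX`; hence `h(PX, Y) = h(X, Y)`, and a short computation gives `R(X,
ξ_i)ξ_i = -PX` (`curvature_ξ_ξ`).

Evaluate `R̄(X, ξ)·∇̄h = 0` on `(Z, ξ, ξ)` with `ξ = ξ_i`. Because `h(·, ξ) = 0`, the fields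
`(∇̄h)(A, ξ, ξ)` vanish, which removes the first two terms. With `W = R(X, ξ)ξ`, each of the other
two contains `(∇̄h)(Z, W, ξ) = -h(W, PZ) = h(X, Z)`. So `-2 h(X, Z) = 0`. The converse is immediate
once `∇` and `R` are known to preserve smooth fields.

The remaining work is foundational: properties of the Levi-Civita connection from the Koszul
formula, metric compatibility and vanishing torsion of the pull-back connection, and the Gauss
formula. -/

namespace GenKenmotsu

set_option linter.unusedSectionVars false

/-! ### Koszul formula, torsion-freeness and metric compatibility. -/

section LeviCivita

variable {E : Type*} [NormedAddCommGroup E] [NormedSpace ℝ E] [FiniteDimensional ℝ E]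
  {M : Type*} [TopologicalSpace M] [ChartedSpace E M] [IsManifold 𝓘(ℝ, E) ∞ M]

theorem IsSmoothVF.mdifferentiableAt {X : Π x : M, TangentSpace 𝓘(ℝ, E) x} (hX : IsSmoothVF X)
    (x : M) : MDiffAt (T% X) x :=
  (hX x).mdifferentiableAt (by simp)

theorem dirDeriv_add {X : Π x : M, TangentSpace 𝓘(ℝ, E) x} {u v : M → ℝ} {x : M}
    (hu : MDiffAt u x) (hv : MDiffAt v x) :
    dirDeriv X (fun y ↦ u y + v y) x = dirDeriv X u x + dirDeriv X v x := by
  simp [dirDeriv, mvfderiv_fun_add hu hv]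

theorem dirDeriv_mul {X : Π x : M, TangentSpace 𝓘(ℝ, E) x} {u v : M → ℝ} {x : M}
    (hu : MDiffAt u x) (hv : MDiffAt v x) :
    dirDeriv X (fun y ↦ u y * v y) x = u x * dirDeriv X v x + v x * dirDeriv X u x := by
  simp [dirDeriv, mvfderiv_fun_mul hu hv]

variable [RiemannianBundle (fun x : M ↦ TangentSpace 𝓘(ℝ, E) x)]
  [IsContMDiffRiemannianBundle 𝓘(ℝ, E) ∞ E (fun x : M ↦ TangentSpace 𝓘(ℝ, E) x)]
  {X X' Y Y' Z : Π x : M, TangentSpace 𝓘(ℝ, E) x} {x : M}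

theorem mdifferentiableAt_inner (hX : MDiffAt (T% X) x) (hY : MDiffAt (T% Y) x) :
    MDiffAt (fun y ↦ inner ℝ (X y) (Y y)) x :=
  MDifferentiableAt.inner_bundle (F := E) (E := fun x : M ↦ TangentSpace 𝓘(ℝ, E) x)
    (b := fun y ↦ y) (v := X) (w := Y) hX hY

/-- The right-hand side of the Koszul formula is tensorial in its last argument. -/
theorem tensorialAt_koszul (hX : MDiffAt (T% X) x) (hY : MDiffAt (T% Y) x) :
    TensorialAt 𝓘(ℝ, E) E (fun Z ↦ koszul X Y Z x) x where
  smul {u Z} hu hZ := by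
    have h1 : dirDeriv X (fun y ↦ inner ℝ (Y y) ((u • Z) y)) x
        = u x * dirDeriv X (fun y ↦ inner ℝ (Y y) (Z y)) x
          + inner ℝ (Y x) (Z x) * dirDeriv X u x := by
      rw [← dirDeriv_mul hu (mdifferentiableAt_inner hY hZ)]
      simp [inner_smul_right]
    have h2 : dirDeriv Y (fun y ↦ inner ℝ (X y) ((u • Z) y)) x
        = u x * dirDeriv Y (fun y ↦ inner ℝ (X y) (Z y)) x
          + inner ℝ (X x) (Z x) * dirDeriv Y u x := by
      rw [← dirDeriv_mul hu (mdifferentiableAt_inner hX hZ)]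
      simp [inner_smul_right]
    have h3 : dirDeriv (u • Z) (fun y ↦ inner ℝ (X y) (Y y)) x
        = u x * dirDeriv Z (fun y ↦ inner ℝ (X y) (Y y)) x := by
      simp [dirDeriv]
    -- The derivatives of `u` produced by the two Leibniz rules cancel against those produced by the
    -- brackets `[X, uZ]` and `[Y, uZ]`.
    simp only [koszul]
    rw [h1, h2, h3]
    simp only [mlieBracket_smul_right hu hZ, inner_add_left, inner_smul_left,
      Pi.smul_apply', inner_smul_right, smul_eq_mul, RCLike.conj_to_real]
    rw [real_inner_comm (Z x) (Y x), real_inner_comm (Z x) (X x)]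
    simp only [dirDeriv]
    ring
  add {Z Z'} hZ hZ' := by
    have h1 : dirDeriv X (fun y ↦ inner ℝ (Y y) ((Z + Z') y)) x
        = dirDeriv X (fun y ↦ inner ℝ (Y y) (Z y)) x
          + dirDeriv X (fun y ↦ inner ℝ (Y y) (Z' y)) x := by
      rw [← dirDeriv_add (mdifferentiableAt_inner hY hZ) (mdifferentiableAt_inner hY hZ')]
      simp [inner_add_right]
    have h2 : dirDeriv Y (fun y ↦ inner ℝ (X y) ((Z + Z') y)) x
        = dirDeriv Y (fun y ↦ inner ℝ (X y) (Z y)) x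
          + dirDeriv Y (fun y ↦ inner ℝ (X y) (Z' y)) x := by
      rw [← dirDeriv_add (mdifferentiableAt_inner hX hZ) (mdifferentiableAt_inner hX hZ')]
      simp [inner_add_right]
    have h3 : dirDeriv (Z + Z') (fun y ↦ inner ℝ (X y) (Y y)) x
        = dirDeriv Z (fun y ↦ inner ℝ (X y) (Y y)) x
          + dirDeriv Z' (fun y ↦ inner ℝ (X y) (Y y)) x := by
      simp [dirDeriv]
    simp only [koszul]
    rw [h1, h2, h3]
    simp only [mlieBracket_add_right hZ hZ', inner_add_left,
      Pi.add_apply, inner_add_right]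
    ring

/-- The Koszul formula. -/
theorem inner_leviCivita (hX : MDiffAt (T% X) x) (hY : MDiffAt (T% Y) x)
    (hZ : MDiffAt (T% Z) x) :
    inner ℝ (leviCivita X Y x) (Z x) = koszul X Y Z x := by
  have hT := tensorialAt_koszul hX hY
  -- By tensoriality the Koszul expression is a linear functional of `Z x`; expanding `Z x` in the
  -- orthonormal basis produces exactly the coefficients in the definition of `leviCivita`.
  rw [← TensorialAt.mkHom_apply hT hZ]
  conv_rhs => rw [← (stdOrthonormalBasis ℝ (TangentSpace 𝓘(ℝ, E) x)).sum_repr' (Z x)]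
  rw [leviCivita, sum_inner, map_sum]
  refine Finset.sum_congr rfl fun a _ ↦ ?_
  rw [map_smul, TensorialAt.mkHom_apply_eq_extend hT, inner_smul_left, smul_eq_mul, mul_comm]
  rfl

theorem eq_of_forall_inner_eq {x : M} {v w : TangentSpace 𝓘(ℝ, E) x}
    (h : ∀ Z : Π x : M, TangentSpace 𝓘(ℝ, E) x, MDiffAt (T% Z) x →
      inner ℝ v (Z x) = inner ℝ w (Z x)) : v = w := by
  refine ext_inner_right ℝ fun z ↦ ?_
  simpa using h (FiberBundle.extend E z) (FiberBundle.mdifferentiableAt_extend ..)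

theorem leviCivita_torsionFree (hX : MDiffAt (T% X) x) (hY : MDiffAt (T% Y) x) :
    leviCivita X Y x - leviCivita Y X x = mlieBracket 𝓘(ℝ, E) X Y x := by
  refine eq_of_forall_inner_eq fun Z hZ ↦ ?_
  rw [inner_sub_left, inner_leviCivita hX hY hZ, inner_leviCivita hY hX hZ]
  simp only [koszul, mlieBracket_swap_apply (V := Y) (W := X), inner_neg_left]
  simp only [real_inner_comm (X _) (Y _)]
  ring

theorem leviCivita_metric (hX : MDiffAt (T% X) x) (hY : MDiffAt (T% Y) x)
    (hZ : MDiffAt (T% Z) x) :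
    dirDeriv X (fun y ↦ inner ℝ (Y y) (Z y)) x
      = inner ℝ (leviCivita X Y x) (Z x) + inner ℝ (Y x) (leviCivita X Z x) := by
  rw [real_inner_comm (leviCivita X Z x), inner_leviCivita hX hY hZ, inner_leviCivita hX hZ hY]
  simp only [koszul, mlieBracket_swap_apply (V := Z) (W := Y), inner_neg_left]
  simp only [real_inner_comm (Y _) (Z _)]
  ring

end LeviCivita

/-! ### Tensoriality, Leibniz rule and locality of the connection. -/

section LeviCivitaRules

variable {E : Type*} [NormedAddCommGroup E] [NormedSpace ℝ E] [FiniteDimensional ℝ E]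
  {M : Type*} [TopologicalSpace M] [ChartedSpace E M] [IsManifold 𝓘(ℝ, E) ∞ M]
  [RiemannianBundle (fun x : M ↦ TangentSpace 𝓘(ℝ, E) x)]
  [IsContMDiffRiemannianBundle 𝓘(ℝ, E) ∞ E (fun x : M ↦ TangentSpace 𝓘(ℝ, E) x)]
  {X X' Y Y' Z : Π x : M, TangentSpace 𝓘(ℝ, E) x} {x : M}

/-- `∇_X Y` is tensorial in `X`. -/
theorem tensorialAt_leviCivita (hY : MDiffAt (T% Y) x) :
    TensorialAt 𝓘(ℝ, E) E (fun X ↦ leviCivita X Y x) x where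
  smul {u X} hu hX := by
    refine eq_of_forall_inner_eq fun Z hZ ↦ ?_
    have h2 : dirDeriv Y (fun y ↦ inner ℝ ((u • X) y) (Z y)) x
        = u x * dirDeriv Y (fun y ↦ inner ℝ (X y) (Z y)) x
          + inner ℝ (X x) (Z x) * dirDeriv Y u x := by
      rw [← dirDeriv_mul hu (mdifferentiableAt_inner hX hZ)]
      simp [inner_smul_left]
    have h3 : dirDeriv Z (fun y ↦ inner ℝ ((u • X) y) (Y y)) x
        = u x * dirDeriv Z (fun y ↦ inner ℝ (X y) (Y y)) x
          + inner ℝ (X x) (Y x) * dirDeriv Z u x := by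
      rw [← dirDeriv_mul hu (mdifferentiableAt_inner hX hY)]
      simp [inner_smul_left]
    have h1 : dirDeriv (u • X) (fun y ↦ inner ℝ (Y y) (Z y)) x
        = u x * dirDeriv X (fun y ↦ inner ℝ (Y y) (Z y)) x := by
      simp [dirDeriv]
    rw [inner_smul_left, inner_leviCivita hX hY hZ, inner_leviCivita (hu.smul_section hX) hY hZ]
    simp only [koszul]
    rw [h1, h2, h3]
    simp only [mlieBracket_smul_left hu hX, inner_add_left, inner_smul_left,
      Pi.smul_apply', inner_smul_right, RCLike.conj_to_real]
    simp only [dirDeriv]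
    ring
  add {X X'} hX hX' := by
    refine eq_of_forall_inner_eq fun Z hZ ↦ ?_
    have h2 : dirDeriv Y (fun y ↦ inner ℝ ((X + X') y) (Z y)) x
        = dirDeriv Y (fun y ↦ inner ℝ (X y) (Z y)) x
          + dirDeriv Y (fun y ↦ inner ℝ (X' y) (Z y)) x := by
      rw [← dirDeriv_add (mdifferentiableAt_inner hX hZ) (mdifferentiableAt_inner hX' hZ)]
      simp [inner_add_left]
    have h3 : dirDeriv Z (fun y ↦ inner ℝ ((X + X') y) (Y y)) x
        = dirDeriv Z (fun y ↦ inner ℝ (X y) (Y y)) x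
          + dirDeriv Z (fun y ↦ inner ℝ (X' y) (Y y)) x := by
      rw [← dirDeriv_add (mdifferentiableAt_inner hX hY) (mdifferentiableAt_inner hX' hY)]
      simp [inner_add_left]
    have h1 : dirDeriv (X + X') (fun y ↦ inner ℝ (Y y) (Z y)) x
        = dirDeriv X (fun y ↦ inner ℝ (Y y) (Z y)) x
          + dirDeriv X' (fun y ↦ inner ℝ (Y y) (Z y)) x := by
      simp [dirDeriv]
    rw [inner_add_left, inner_leviCivita hX hY hZ, inner_leviCivita hX' hY hZ,
      inner_leviCivita (mdifferentiableAt_add_section hX hX') hY hZ]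
    simp only [koszul]
    rw [h1, h2, h3]
    simp only [mlieBracket_add_left hX hX', inner_add_left, Pi.add_apply, inner_add_right]
    ring

/-- Exchanges the two arguments, so that the rules in the second argument follow from tensoriality
in the first together with the known rules for the Lie bracket. -/
theorem leviCivita_eq_add_mlieBracket (hX : MDiffAt (T% X) x) (hY : MDiffAt (T% Y) x) :
    leviCivita X Y x = leviCivita Y X x + mlieBracket 𝓘(ℝ, E) X Y x := by
  rw [← leviCivita_torsionFree hX hY]
  abel

theorem leviCivita_add (hX : MDiffAt (T% X) x) (hY : MDiffAt (T% Y) x)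
    (hY' : MDiffAt (T% Y') x) :
    leviCivita X (Y + Y') x = leviCivita X Y x + leviCivita X Y' x := by
  rw [leviCivita_eq_add_mlieBracket hX hY, leviCivita_eq_add_mlieBracket hX hY',
    leviCivita_eq_add_mlieBracket hX (mdifferentiableAt_add_section hY hY'),
    (tensorialAt_leviCivita hX).add hY hY', mlieBracket_add_right hY hY']
  abel

theorem leviCivita_smul {u : M → ℝ} (hu : MDiffAt u x) (hX : MDiffAt (T% X) x)
    (hY : MDiffAt (T% Y) x) :
    leviCivita X (u • Y) x = u x • leviCivita X Y x + dirDeriv X u x • Y x := by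
  rw [leviCivita_eq_add_mlieBracket hX hY,
    leviCivita_eq_add_mlieBracket hX (hu.smul_section hY),
    (tensorialAt_leviCivita hX).smul hu hY, mlieBracket_smul_right hu hY, smul_add, dirDeriv]
  abel

theorem leviCivita_zero (hX : MDiffAt (T% X) x) :
    leviCivita X (0 : Π x : M, TangentSpace 𝓘(ℝ, E) x) x = 0 := by
  have h0 : MDiffAt (T% (0 : Π x : M, TangentSpace 𝓘(ℝ, E) x)) x :=
    mdifferentiableAt_zeroSection ..
  simpa using leviCivita_add hX h0 h0

theorem leviCivita_sum_smul {ι : Type*} (s : Finset ι) {u : ι → M → ℝ}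
    {Y : ι → Π x : M, TangentSpace 𝓘(ℝ, E) x} (hX : MDiffAt (T% X) x)
    (hu : ∀ i, MDiffAt (u i) x) (hY : ∀ i, MDiffAt (T% (Y i)) x) :
    leviCivita X (fun y ↦ ∑ i ∈ s, u i y • Y i y) x
      = ∑ i ∈ s, (u i x • leviCivita X (Y i) x + dirDeriv X (u i) x • Y i x) := by
  classical
  induction s using Finset.induction_on with
  | empty => simpa using! leviCivita_zero hX
  | insert a s ha ih =>
    have hs : MDiffAt (T% (fun y ↦ ∑ i ∈ s, u i y • Y i y)) x :=
      .sum_section fun i _ ↦ (hu i).smul_section (hY i)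
    rw [Finset.sum_insert ha, ← ih, ← leviCivita_smul (hu a) hX (hY a),
      ← leviCivita_add hX ((hu a).smul_section (hY a)) hs]
    congr 1
    ext y
    simp [Finset.sum_insert ha]

theorem leviCivita_congr_left (hX : MDiffAt (T% X) x) (hX' : MDiffAt (T% X') x)
    (hY : MDiffAt (T% Y) x) (h : X x = X' x) : leviCivita X Y x = leviCivita X' Y x :=
  (tensorialAt_leviCivita hY).pointwise hX hX' h

theorem leviCivita_congr_right (hX : MDiffAt (T% X) x) (hY : MDiffAt (T% Y) x)
    (hY' : MDiffAt (T% Y') x) (h : Y =ᶠ[𝓝 x] Y') : leviCivita X Y x = leviCivita X Y' x := by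
  rw [leviCivita_eq_add_mlieBracket hX hY, leviCivita_eq_add_mlieBracket hX hY',
    leviCivita_congr_left hY hY' hX h.self_of_nhds,
    Filter.EventuallyEq.mlieBracket_vectorField_eq (Filter.EventuallyEq.refl (𝓝 x) X) h]

end LeviCivitaRules

/-! ### Global smooth extensions; smoothness of `∇` and `R`. -/

section Smoothness

variable {E : Type*} [NormedAddCommGroup E] [NormedSpace ℝ E] [FiniteDimensional ℝ E]
  {M : Type*} [TopologicalSpace M] [ChartedSpace E M] [IsManifold 𝓘(ℝ, E) ∞ M]

/-- A vector field which is smooth on the chart domain of `x` agrees near `x` with a globally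
smooth one. -/
theorem exists_isSmoothVF_eventuallyEq [T2Space M] {X : Π x : M, TangentSpace 𝓘(ℝ, E) x} {x : M}
    (hX : CMDiff[(chartAt E x).source] ∞ (T% X)) :
    ∃ X' : Π x : M, TangentSpace 𝓘(ℝ, E) x, IsSmoothVF X' ∧ X' =ᶠ[𝓝 x] X := by
  obtain ⟨ψ⟩ : Nonempty (SmoothBumpFunction 𝓘(ℝ, E) x) := inferInstance
  refine ⟨(ψ : M → ℝ) • X, ?_, ?_⟩
  · exact ContMDiffOn.smul_section_of_tsupport ψ.contMDiff.contMDiffOn (chartAt E x).open_source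
      ψ.tsupport_subset_chartAt_source hX
  · filter_upwards [ψ.eventuallyEq_one] with y hy
    simp only [Pi.smul_apply', hy, Pi.one_apply]
    exact one_smul ℝ (X y)

/-- The extension with constant components is smooth on a chart domain, and a bump function makes it
global. This gives access to hypotheses that quantify only over global smooth fields. -/
theorem exists_isSmoothVF_eq [T2Space M] {x : M} (v : TangentSpace 𝓘(ℝ, E) x) :
    ∃ X : Π x : M, TangentSpace 𝓘(ℝ, E) x, IsSmoothVF X ∧ X x = v := by
  have hX : CMDiff[(chartAt E x).source] ∞ (T% (FiberBundle.extend E v)) := by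
    set t := trivializationAt E (TangentSpace 𝓘(ℝ, E) : M → Type _) x
    suffices CMDiff[t.baseSet] ∞ (fun y ↦ (t ⟨y, FiberBundle.extend E v y⟩).2) by
      intro y hy
      rw [t.contMDiffWithinAt_section _ (by simpa [t] using! hy)]
      exact this y (by simpa [t] using! hy)
    exact (contMDiffOn_const (c := (t ⟨x, v⟩).2)).congr
      fun y hy ↦ (congrArg Prod.snd (t.apply_mk_symm hy (t ⟨x, v⟩).2) :)
  obtain ⟨X', hX', h⟩ := exists_isSmoothVF_eventuallyEq hX
  exact ⟨X', hX', h.self_of_nhds.trans (FiberBundle.extend_apply_self ..)⟩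

theorem contMDiffAt_det {ι : Type*} [Fintype ι] [DecidableEq ι] {A : M → Matrix ι ι ℝ} {x : M}
    (hA : ∀ i j, CMDiffAt ∞ (fun y ↦ A y i j) x) : CMDiffAt ∞ (fun y ↦ (A y).det) x := by
  simp only [Matrix.det_apply']
  exact contMDiffAt_finsetSum fun σ _ ↦ contMDiffAt_const.mul
    (contMDiffAt_finsetProd fun i _ ↦ hA _ _)

theorem contMDiffAt_matrix_inv {ι : Type*} [Fintype ι] [DecidableEq ι] {A : M → Matrix ι ι ℝ}
    {x : M} (hA : ∀ i j, CMDiffAt ∞ (fun y ↦ A y i j) x) (hdet : (A x).det ≠ 0) (i j : ι) :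
    CMDiffAt ∞ (fun y ↦ (A y)⁻¹ i j) x := by
  simp only [Matrix.inv_def, Ring.inverse_eq_inv', Matrix.smul_apply, smul_eq_mul,
    Matrix.adjugate_apply]
  refine ((contMDiffAt_det hA).inv₀ hdet).mul (contMDiffAt_det fun k l ↦ ?_)
  by_cases hk : k = j
  · subst hk
    simpa using contMDiffAt_const
  · simpa [Matrix.updateRow_ne hk] using hA k l

/-- `X(u)` is the fibre component of the tangent map of `u` composed with the section `X`. -/
theorem contMDiff_dirDeriv {X : Π x : M, TangentSpace 𝓘(ℝ, E) x} (hX : IsSmoothVF X)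
    {u : M → ℝ} (hu : CMDiff ∞ u) : CMDiff ∞ (dirDeriv X u) := by
  have h := (hu.contMDiff_tangentMap (m := ∞) (by simp)).comp hX
  have h2 := fun x ↦ (contMDiffAt_totalSpace.1 (h x)).2
  intro x
  simpa [dirDeriv, tangentMap, mvfderiv] using! h2 x

theorem IsSmoothVF.mlieBracket {X Y : Π x : M, TangentSpace 𝓘(ℝ, E) x} (hX : IsSmoothVF X)
    (hY : IsSmoothVF Y) : IsSmoothVF (mlieBracket 𝓘(ℝ, E) X Y) :=
  haveI : IsManifold 𝓘(ℝ, E) (minSmoothness ℝ 2) M :=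
    IsManifold.of_le (n := ∞) (by simpa using ENat.LEInfty.out)
  -- The bracket costs one derivative, which is harmless because `∞ + 1` unfolds to `∞`.
  haveI : IsManifold 𝓘(ℝ, E) (((⊤ : ℕ∞) : ℕ∞ω) + 1) M := inferInstanceAs (IsManifold 𝓘(ℝ, E) ∞ M)
  ContDiff.mlieBracket_vectorField (m := ⊤) (n := ⊤) hX hY (by simp)

variable [RiemannianBundle (fun x : M ↦ TangentSpace 𝓘(ℝ, E) x)]
  [IsContMDiffRiemannianBundle 𝓘(ℝ, E) ∞ E (fun x : M ↦ TangentSpace 𝓘(ℝ, E) x)]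

theorem IsSmoothVF.contMDiff_inner {X Y : Π x : M, TangentSpace 𝓘(ℝ, E) x} (hX : IsSmoothVF X)
    (hY : IsSmoothVF Y) : CMDiff ∞ (fun y ↦ inner ℝ (X y) (Y y)) :=
  ContMDiff.inner_bundle (F := E) (E := fun x : M ↦ TangentSpace 𝓘(ℝ, E) x)
    (b := fun y ↦ y) (v := X) (w := Y) hX hY

/-- A vector field whose inner products with all smooth vector fields are smooth is smooth. -/
theorem isSmoothVF_of_inner [T2Space M] {W : Π x : M, TangentSpace 𝓘(ℝ, E) x}
    (hW : ∀ Z : Π x : M, TangentSpace 𝓘(ℝ, E) x, IsSmoothVF Z →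
      CMDiff ∞ (fun y ↦ inner ℝ (W y) (Z y))) : IsSmoothVF W := by
  intro x
  let t := trivializationAt E (TangentSpace 𝓘(ℝ, E) : M → Type _) x
  let b := Module.finBasis ℝ E
  have hxt : x ∈ t.baseSet := FiberBundle.mem_baseSet_trivializationAt' x
  have hfr := t.isLocalFrameOn_localFrame_baseSet 𝓘(ℝ, E) ∞ b
  -- The hypothesis tests `W` only against global smooth fields, so the local frame is replaced by
  -- global fields agreeing with it near `x`.
  choose Z hZ hZt using fun i ↦ exists_isSmoothVF_eventuallyEq (x := x) (hfr.contMDiffOn i)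
  rw [contMDiffAt_iff_localFrameCoeff b hxt]
  intro i
  -- The frame coefficients of `W` are the vector of inner products `⟨W, Z j⟩` times the inverse
  -- Gram matrix, and this expression is smooth by Cramer's rule.
  let G : M → Matrix _ _ ℝ := fun y ↦ Matrix.gram ℝ (fun i ↦ Z i y)
  have hG (i j) : CMDiffAt ∞ (fun y ↦ G y i j) x := (hZ i).contMDiff_inner (hZ j) x
  have hnear : ∀ᶠ y in 𝓝 x, y ∈ t.baseSet ∧ ∀ i, Z i y = t.localFrame b i y :=
    Filter.Eventually.and (t.open_baseSet.mem_nhds hxt) (Filter.eventually_all.2 hZt)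
  have hdet : ∀ᶠ y in 𝓝 x, (G y).det ≠ 0 := by
    filter_upwards [hnear] with y ⟨hy, hZy⟩
    refine Matrix.det_gram_ne_zero_iff_linearIndependent.2 ?_
    simp only [hZy]
    exact hfr.linearIndependent hy
  have hsm : CMDiffAt ∞ (fun y ↦ ∑ j, inner ℝ (W y) (Z j y) * (G y)⁻¹ j i) x :=
    contMDiffAt_finsetSum fun j _ ↦ (hW _ (hZ j) x).mul
      (contMDiffAt_matrix_inv hG hdet.self_of_nhds j i)
  refine hsm.congr_of_eventuallyEq ?_
  filter_upwards [hnear, hdet] with y ⟨hy, hZy⟩ hd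
  have hWy := t.eq_sum_localFrameCoeff_smul (I := 𝓘(ℝ, E)) (b := b) (s := W) hy
  simp only [← hZy] at hWy
  have key : (fun j ↦ inner ℝ (W y) (Z j y))
      = Matrix.vecMul (fun i ↦ t.localFrameCoeff 𝓘(ℝ, E) b i y (W y)) (G y) := by
    ext j
    conv_lhs => rw [hWy]
    simp [sum_inner, inner_smul_left, Matrix.vecMul, dotProduct, G, Matrix.gram_apply]
  have := congrFun (congrArg (fun v ↦ Matrix.vecMul v (G y)⁻¹) key) i
  simp only [Matrix.vecMul_vecMul, Matrix.mul_nonsing_inv _ (isUnit_iff_ne_zero.2 hd),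
    Matrix.vecMul_one] at this
  exact this.symm

theorem IsSmoothVF.leviCivita [T2Space M] {X Y : Π x : M, TangentSpace 𝓘(ℝ, E) x}
    (hX : IsSmoothVF X) (hY : IsSmoothVF Y) : IsSmoothVF (leviCivita X Y) := by
  refine isSmoothVF_of_inner fun Z hZ ↦ ?_
  have : (fun y ↦ inner ℝ (GenKenmotsu.leviCivita X Y y) (Z y)) = koszul X Y Z := by
    ext y
    exact inner_leviCivita (hX.mdifferentiableAt y) (hY.mdifferentiableAt y)
      (hZ.mdifferentiableAt y)
  rw [this]
  exact contMDiff_const.mul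
    ((((((contMDiff_dirDeriv hX (hY.contMDiff_inner hZ)).add
      (contMDiff_dirDeriv hY (hX.contMDiff_inner hZ))).sub
      (contMDiff_dirDeriv hZ (hX.contMDiff_inner hY))).add
      ((hX.mlieBracket hY).contMDiff_inner hZ)).sub
      ((hX.mlieBracket hZ).contMDiff_inner hY)).sub ((hY.mlieBracket hZ).contMDiff_inner hX))

theorem IsSmoothVF.curvature [T2Space M] {X Y Z : Π x : M, TangentSpace 𝓘(ℝ, E) x}
    (hX : IsSmoothVF X) (hY : IsSmoothVF Y) (hZ : IsSmoothVF Z) :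
    IsSmoothVF (curvature X Y Z) :=
  ((hX.leviCivita (hY.leviCivita hZ)).sub_section (hY.leviCivita (hX.leviCivita hZ))).sub_section
    ((hX.mlieBracket hY).leviCivita hZ)

end Smoothness

/-! ### The Lie bracket as a commutator of derivations, for vector-valued functions. -/

section Bracket

variable {E F : Type*} [NormedAddCommGroup E] [NormedSpace ℝ E] [FiniteDimensional ℝ E]
  [NormedAddCommGroup F] [NormedSpace ℝ F]
  {M : Type*} [TopologicalSpace M] [ChartedSpace E M] [IsManifold 𝓘(ℝ, E) ∞ M]

theorem mvfderiv_apply_congr {φ ψ : M → F} {x : M} (h : φ =ᶠ[𝓝 x] ψ)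
    (v : TangentSpace 𝓘(ℝ, E) x) : mvfderiv 𝓘(ℝ, E) φ x v = mvfderiv 𝓘(ℝ, E) ψ x v := by
  have := h.mfderiv_eq (I := 𝓘(ℝ, E)) (I' := 𝓘(ℝ, F))
  exact congrArg (fun L : E →L[ℝ] F ↦ L v) this

theorem mvfderiv_comp_extChartAt {g : E → F} {x : M}
    (hg : DifferentiableAt ℝ g (extChartAt 𝓘(ℝ, E) x x)) (v : TangentSpace 𝓘(ℝ, E) x) :
    mvfderiv 𝓘(ℝ, E) (g ∘ extChartAt 𝓘(ℝ, E) x) x v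
      = fderiv ℝ g (extChartAt 𝓘(ℝ, E) x x) v := by
  have h := mfderiv_comp x hg.mdifferentiableAt
    (mdifferentiableAt_extChartAt (I := 𝓘(ℝ, E)) (mem_chart_source E x))
  rw [mfderiv_eq_fderiv] at h
  have h1 : mfderiv 𝓘(ℝ, E) 𝓘(ℝ, E) (extChartAt 𝓘(ℝ, E) x) x v = v :=
    congrArg (fun L : E →L[ℝ] E ↦ L v) (mfderiv_extChartAt_self (I := 𝓘(ℝ, E)) (x := x))
  exact (congrArg (fun L : E →L[ℝ] F ↦ L v) h).trans (congrArg (fderiv ℝ g _) h1)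

/-- The derivative of a vector-valued function along a vector field, in a chart. -/
theorem mvfderiv_apply_eventuallyEq_chart {φ : M → F} {x : M} (hφ : CMDiffAt 2 φ x)
    (Y : Π x : M, TangentSpace 𝓘(ℝ, E) x) :
    (fun y ↦ mvfderiv 𝓘(ℝ, E) φ y (Y y)) =ᶠ[𝓝 x]
      (fun z : E ↦ fderiv ℝ (φ ∘ (extChartAt 𝓘(ℝ, E) x).symm) z
        (mpullbackWithin 𝓘(ℝ, E) 𝓘(ℝ, E) (extChartAt 𝓘(ℝ, E) x).symm Y
          (Set.range 𝓘(ℝ, E)) z)) ∘ extChartAt 𝓘(ℝ, E) x := by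
  set c := extChartAt 𝓘(ℝ, E) x
  have key : ∀ z ∈ c.target, MDiffAt φ (c.symm z) →
      fderiv ℝ (φ ∘ c.symm) z (mpullbackWithin 𝓘(ℝ, E) 𝓘(ℝ, E) c.symm Y (Set.range 𝓘(ℝ, E)) z)
        = mvfderiv 𝓘(ℝ, E) φ (c.symm z) (Y (c.symm z)) := by
    intro z hz hφz
    have hinv : (mfderivWithin 𝓘(ℝ, E) 𝓘(ℝ, E) c.symm (Set.range 𝓘(ℝ, E)) z).IsInvertible :=
      isInvertible_mfderivWithin_extChartAt_symm hz
    have hc : MDifferentiableAt 𝓘(ℝ, E) 𝓘(ℝ, E) c.symm z := by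
      have := mdifferentiableWithinAt_extChartAt_symm (I := 𝓘(ℝ, E)) hz
      rwa [modelWithCornersSelf_coe, Set.range_id, mdifferentiableWithinAt_univ] at this
    have hcomp := mfderiv_comp z hφz hc
    rw [mfderiv_eq_fderiv] at hcomp
    rw [hcomp, mpullbackWithin_apply]
    simp only [modelWithCornersSelf_coe, Set.range_id, mfderivWithin_univ] at hinv ⊢
    -- The inverse of `d(c⁻¹)` in the pull-back of `Y` cancels the `d(c⁻¹)` coming from the chain
    -- rule.
    exact congrArg _ (hinv.self_apply_inverse _)
  have h1 : ∀ᶠ y in 𝓝 x, MDiffAt φ y := by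
    filter_upwards [(contMDiffAt_iff_contMDiffAt_nhds (by simp)).1 hφ] with y hy
    exact hy.mdifferentiableAt (by simp)
  filter_upwards [h1, extChartAt_source_mem_nhds (I := 𝓘(ℝ, E)) x] with y hy hys
  have hcy : c.symm (c y) = y := c.left_inv hys
  have := key (c y) (c.map_source hys) (by rwa [hcy])
  rw [Function.comp_apply, this]
  exact (congrArg (fun y ↦ mvfderiv 𝓘(ℝ, E) φ y (Y y)) hcy).symm

/-- `[X, Y] φ = X (Y φ) - Y (X φ)` for vector-valued functions `φ`. -/
theorem mvfderiv_mlieBracket {φ : M → F} {x : M} (hφ : CMDiffAt 2 φ x)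
    {X Y : Π x : M, TangentSpace 𝓘(ℝ, E) x} (hX : MDiffAt (T% X) x) (hY : MDiffAt (T% Y) x) :
    mvfderiv 𝓘(ℝ, E) φ x (mlieBracket 𝓘(ℝ, E) X Y x)
      = mvfderiv 𝓘(ℝ, E) (fun y ↦ mvfderiv 𝓘(ℝ, E) φ y (Y y)) x (X x)
        - mvfderiv 𝓘(ℝ, E) (fun y ↦ mvfderiv 𝓘(ℝ, E) φ y (X y)) x (Y x) := by
  let c := extChartAt 𝓘(ℝ, E) x
  let φ' : E → F := φ ∘ c.symm
  let P : (Π x : M, TangentSpace 𝓘(ℝ, E) x) → E → E := fun X ↦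
    mpullbackWithin 𝓘(ℝ, E) 𝓘(ℝ, E) c.symm X (Set.range 𝓘(ℝ, E))
  have hset : c.symm ⁻¹' Set.univ ∩ Set.range 𝓘(ℝ, E) = Set.univ := by simp
  have hP (X : Π x : M, TangentSpace 𝓘(ℝ, E) x) (hX : MDiffAt (T% X) x) :
      DifferentiableAt ℝ (P X) (c x) := by
    have := (mdifferentiableWithinAt_univ.2 hX).differentiableWithinAt_mpullbackWithin_vectorField
    rw [hset] at this
    exact differentiableWithinAt_univ.1 this
  have hPx (X : Π x : M, TangentSpace 𝓘(ℝ, E) x) : P X (c x) = X x := by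
    have hx : c.symm (c x) = x := c.left_inv (mem_extChartAt_source x)
    have h1 := mfderivWithin_extChartAt_symm_inverse_apply (I := 𝓘(ℝ, E)) (x := x)
      (X (c.symm (c x)) : E)
    exact (h1 :).trans (congrArg (fun y ↦ (X y : E)) hx)
  have hφ' : ContDiffAt ℝ 2 φ' (c x) := by
    have := (contMDiffAt_iff.1 hφ).2
    simpa [contDiffWithinAt_univ] using! this
  have hd (X Y : Π x : M, TangentSpace 𝓘(ℝ, E) x) (hY : MDiffAt (T% Y) x) :
      mvfderiv 𝓘(ℝ, E) (fun y ↦ mvfderiv 𝓘(ℝ, E) φ y (Y y)) x (X x)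
        = fderiv ℝ (fun z ↦ fderiv ℝ φ' z (P Y z)) (c x) (P X (c x)) := by
    have hg : DifferentiableAt ℝ (fun z ↦ fderiv ℝ φ' z (P Y z)) (c x) :=
      ((hφ'.fderiv_right (m := 1) (by norm_num)).differentiableAt one_ne_zero).clm_apply (hP Y hY)
    rw [hPx, mvfderiv_apply_congr (mvfderiv_apply_eventuallyEq_chart hφ Y)]
    exact mvfderiv_comp_extChartAt hg _
  -- The chart at `x` has identity derivative at its own centre, so the manifold bracket at `x` is
  -- the bracket of the chart representatives, with no correction.
  have hbr : mlieBracket 𝓘(ℝ, E) X Y x = lieBracket ℝ (P X) (P Y) (c x) := by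
    have hinv (v : E) : (mfderiv 𝓘(ℝ, E) 𝓘(ℝ, E) c x).inverse v = v :=
      congrArg (fun L : E →L[ℝ] E ↦ L.inverse v) (mfderiv_extChartAt_self (I := 𝓘(ℝ, E)) (x := x))
        |>.trans
          (congrArg (fun L : E →L[ℝ] E ↦ L v) (ContinuousLinearMap.inverse_id (R := ℝ) (M := E)))
    rw [← mlieBracketWithin_univ, mlieBracketWithin_apply, hset]
    exact (hinv _).trans (congrFun (lieBracketWithin_univ (V := P X) (W := P Y)) _)
  have h0 (v : E) : mvfderiv 𝓘(ℝ, E) φ x v = fderiv ℝ φ' (c x) v := by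
    have := congrArg (fun L : E →L[ℝ] F ↦ L v) (hφ.mdifferentiableAt (by simp)).mvfderiv
    rw [modelWithCornersSelf_coe, Set.range_id, fderivWithin_univ] at this
    exact this
  -- Symmetry of the second derivative is what cancels the second-order terms in the commutator.
  have hs : IsSymmSndFDerivAt ℝ φ' (c x) := hφ'.isSymmSndFDerivAt (by simp)
  rw [hd X Y hY, hd Y X hX, hbr]
  exact (h0 _).trans (fderiv_apply_lieBracket_of_isSymmSndFDerivAt hφ' hs (hP Y hY) (hP X hX))

end Bracket

/-! ### Vector fields along a map and the pull-back connection in a local frame. -/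

section Along

variable {E F : Type*} [NormedAddCommGroup E] [NormedSpace ℝ E] [FiniteDimensional ℝ E]
  [NormedAddCommGroup F] [NormedSpace ℝ F] [FiniteDimensional ℝ F]
  {M : Type*} [TopologicalSpace M] [ChartedSpace E M] [IsManifold 𝓘(ℝ, E) ∞ M]
  {N : Type*} [TopologicalSpace N] [ChartedSpace F N] [IsManifold 𝓘(ℝ, F) ∞ N]

/-- The local frame of `TN` given by the trivialization at `p`. -/
def coordFrame (p : N) (i : Fin (Module.finrank ℝ F)) (q : N) : TangentSpace 𝓘(ℝ, F) q :=
  (trivializationAt F (TangentSpace 𝓘(ℝ, F) : N → Type _) p).symm q (Module.finBasis ℝ F i)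

/-- The components of a vector field along `f` in the trivialization at `f x`. -/
def coordAlong (f : M → N) (V : Π x : M, TangentSpace 𝓘(ℝ, F) (f x)) (x : M)
    (i : Fin (Module.finrank ℝ F)) (y : M) : ℝ :=
  (Module.finBasis ℝ F).repr
    (trivializationAt F (TangentSpace 𝓘(ℝ, F) : N → Type _) (f x) ⟨f y, V y⟩).2 i

variable (E) in
/-- The vector field `V` along `f` is differentiable at `x`. -/
def DiffAlongAt (f : M → N) (V : Π x : M, TangentSpace 𝓘(ℝ, F) (f x)) (x : M) : Prop :=
  MDifferentiableAt 𝓘(ℝ, E) 𝓘(ℝ, F).tangent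
    (fun y ↦ (⟨f y, V y⟩ : TangentBundle 𝓘(ℝ, F) N)) x

/-- A frame field has constant components in the trivialization at `p`, hence is the extension of
its own value at `p`. -/
theorem mdifferentiableAt_coordFrame (p : N) (i : Fin (Module.finrank ℝ F)) :
    MDiffAt (T% (coordFrame p i)) p := by
  have h := FiberBundle.mdifferentiableAt_extend 𝓘(ℝ, F) F (coordFrame p i p)
  have heq : FiberBundle.extend F (coordFrame p i p) = coordFrame p i := by
    ext q
    simp only [FiberBundle.extend, coordFrame]
    rw [Trivialization.apply_mk_symm _ (FiberBundle.mem_baseSet_trivializationAt' p)]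
  rwa [heq] at h

theorem coordFrame_sum_repr {p q : N}
    (hq : q ∈ (trivializationAt F (TangentSpace 𝓘(ℝ, F) : N → Type _) p).baseSet) (w : F) :
    (trivializationAt F (TangentSpace 𝓘(ℝ, F) : N → Type _) p).symm q w
      = ∑ i, (Module.finBasis ℝ F).repr w i • coordFrame p i q := by
  conv_lhs => rw [← (Module.finBasis ℝ F).sum_repr w]
  have := Trivialization.coe_symmₗ (R := ℝ)
    (trivializationAt F (TangentSpace 𝓘(ℝ, F) : N → Type _) p) hq
  simp only [coordFrame, ← this, map_sum, map_smul]

theorem extend_eq_sum_coordFrame {p q : N} (v : TangentSpace 𝓘(ℝ, F) p)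
    (hq : q ∈ (trivializationAt F (TangentSpace 𝓘(ℝ, F) : N → Type _) p).baseSet) :
    FiberBundle.extend F v q = ∑ i, (Module.finBasis ℝ F).repr
      (trivializationAt F (TangentSpace 𝓘(ℝ, F) : N → Type _) p ⟨p, v⟩).2 i • coordFrame p i q :=
  coordFrame_sum_repr hq _

variable {f : M → N} {V W : Π x : M, TangentSpace 𝓘(ℝ, F) (f x)} {x : M}

theorem DiffAlongAt.mdifferentiableAt (hV : DiffAlongAt E f V x) :
    MDifferentiableAt 𝓘(ℝ, E) 𝓘(ℝ, F) f x :=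
  ((mdifferentiableAt_totalSpace _ _).1 hV).1

theorem DiffAlongAt.mdifferentiableAt_triv (hV : DiffAlongAt E f V x) :
    MDiffAt (fun y ↦ (trivializationAt F (TangentSpace 𝓘(ℝ, F) : N → Type _) (f x)
      ⟨f y, V y⟩).2) x :=
  ((mdifferentiableAt_totalSpace _ _).1 hV).2

theorem DiffAlongAt.mdifferentiableAt_coordAlong (hV : DiffAlongAt E f V x)
    (i : Fin (Module.finrank ℝ F)) : MDiffAt (coordAlong f V x i) x :=
  (LinearMap.toContinuousLinearMap
    ((Module.finBasis ℝ F).coord i)).mdifferentiableAt.comp x hV.mdifferentiableAt_triv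

theorem DiffAlongAt.dirDeriv_coordAlong (hV : DiffAlongAt E f V x)
    (X : Π x : M, TangentSpace 𝓘(ℝ, E) x) (i : Fin (Module.finrank ℝ F)) :
    dirDeriv X (coordAlong f V x i) x = (Module.finBasis ℝ F).repr (mvfderiv 𝓘(ℝ, E)
      (fun y ↦ (trivializationAt F (TangentSpace 𝓘(ℝ, F) : N → Type _) (f x) ⟨f y, V y⟩).2)
      x (X x)) i := by
  have h := mfderiv_comp x (LinearMap.toContinuousLinearMap
    ((Module.finBasis ℝ F).coord i)).mdifferentiableAt hV.mdifferentiableAt_triv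
  rw [ContinuousLinearMap.mfderiv_eq] at h
  exact congrArg (fun L : E →L[ℝ] ℝ ↦ L (X x)) h

theorem eventually_eq_sum_coordAlong (hf : ContinuousAt f x)
    (V : Π x : M, TangentSpace 𝓘(ℝ, F) (f x)) :
    ∀ᶠ y in 𝓝 x, V y = ∑ i, coordAlong f V x i y • coordFrame (f x) i (f y) := by
  have hb := hf.preimage_mem_nhds
    ((trivializationAt F (TangentSpace 𝓘(ℝ, F) : N → Type _) (f x)).open_baseSet.mem_nhds
      (FiberBundle.mem_baseSet_trivializationAt' (f x)))
  filter_upwards [hb] with y hy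
  have h := coordFrame_sum_repr (q := f y) hy
    (trivializationAt F (TangentSpace 𝓘(ℝ, F) : N → Type _) (f x) ⟨f y, V y⟩).2
  rwa [Trivialization.symm_apply_apply_mk (trivializationAt F (TangentSpace 𝓘(ℝ, F)) (f x))
    (b := f y) hy (V y)] at h

variable [RiemannianBundle (fun x : N ↦ TangentSpace 𝓘(ℝ, F) x)]
  [IsContMDiffRiemannianBundle 𝓘(ℝ, F) ∞ F (fun x : N ↦ TangentSpace 𝓘(ℝ, F) x)]

/-- The pull-back connection in terms of the local frame at `f x`. -/
theorem covAlong_eq_sum (hV : DiffAlongAt E f V x) (X : Π x : M, TangentSpace 𝓘(ℝ, E) x) :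
    covAlong f X V x = ∑ i, (dirDeriv X (coordAlong f V x i) x • coordFrame (f x) i (f x)
      + coordAlong f V x i x • leviCivita
        (FiberBundle.extend F (mfderiv 𝓘(ℝ, E) 𝓘(ℝ, F) f x (X x))) (coordFrame (f x) i) (f x)) := by
  have hbase : f x ∈ (trivializationAt F (TangentSpace 𝓘(ℝ, F) : N → Type _) (f x)).baseSet :=
    FiberBundle.mem_baseSet_trivializationAt' (f x)
  have h2 : leviCivita (FiberBundle.extend F (mfderiv 𝓘(ℝ, E) 𝓘(ℝ, F) f x (X x)))
        (FiberBundle.extend F (V x)) (f x)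
      = ∑ i, coordAlong f V x i x • leviCivita
        (FiberBundle.extend F (mfderiv 𝓘(ℝ, E) 𝓘(ℝ, F) f x (X x))) (coordFrame (f x) i) (f x) := by
    have hX := FiberBundle.mdifferentiableAt_extend 𝓘(ℝ, F) F
      (mfderiv 𝓘(ℝ, E) 𝓘(ℝ, F) f x (X x))
    -- The coefficients are frozen at `x`: the extension of `V x` has constant components, so the
    -- Leibniz terms vanish and only derivatives of the frame survive.
    have hsum := leviCivita_sum_smul Finset.univ (u := fun i _ ↦ coordAlong f V x i x) hX
      (fun i ↦ mdifferentiableAt_const) (mdifferentiableAt_coordFrame (f x))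
    rw [leviCivita_congr_right hX (FiberBundle.mdifferentiableAt_extend ..)
      (.sum_section fun i _ ↦ MDifferentiableAt.smul_section
        (mdifferentiableAt_const (c := coordAlong f V x i x)) (mdifferentiableAt_coordFrame (f x) i))
      ?_]
    · refine hsum.trans (Finset.sum_congr rfl fun i _ ↦ ?_)
      simp [dirDeriv, mvfderiv_const]
    · filter_upwards [(trivializationAt F (TangentSpace 𝓘(ℝ, F) : N → Type _)
        (f x)).open_baseSet.mem_nhds hbase] with q hq
      exact extend_eq_sum_coordFrame _ hq
  rw [covAlong, h2, coordFrame_sum_repr hbase, Finset.sum_add_distrib]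
  simp only [hV.dirDeriv_coordAlong]

end Along

/-! ### Metric compatibility and vanishing torsion of the pull-back connection. -/

section AlongRules

variable {E F : Type*} [NormedAddCommGroup E] [NormedSpace ℝ E] [FiniteDimensional ℝ E]
  [NormedAddCommGroup F] [NormedSpace ℝ F] [FiniteDimensional ℝ F]
  {M : Type*} [TopologicalSpace M] [ChartedSpace E M] [IsManifold 𝓘(ℝ, E) ∞ M]
  {N : Type*} [TopologicalSpace N] [ChartedSpace F N] [IsManifold 𝓘(ℝ, F) ∞ N]

theorem mdifferentiableAt_sum {ι : Type*} (s : Finset ι) {u : ι → M → ℝ} {x : M}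
    (hu : ∀ i, MDiffAt (u i) x) : MDiffAt (fun y ↦ ∑ i ∈ s, u i y) x := by
  classical
  induction s using Finset.induction_on with
  | empty => simpa using! mdifferentiableAt_const
  | insert a s ha ih =>
    simp only [Finset.sum_insert ha]
    exact (hu a).add ih

theorem dirDeriv_sum {X : Π x : M, TangentSpace 𝓘(ℝ, E) x} {ι : Type*} (s : Finset ι)
    {u : ι → M → ℝ} {x : M} (hu : ∀ i, MDiffAt (u i) x) :
    dirDeriv X (fun y ↦ ∑ i ∈ s, u i y) x = ∑ i ∈ s, dirDeriv X (u i) x := by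
  classical
  induction s using Finset.induction_on with
  | empty => simp [dirDeriv, mvfderiv_const]
  | insert a s ha ih =>
    simp only [Finset.sum_insert ha, ← ih]
    exact dirDeriv_add (hu a) (mdifferentiableAt_sum s hu)

variable {f : M → N} {V W : Π x : M, TangentSpace 𝓘(ℝ, F) (f x)} {x : M}
  {X Y Z : Π x : M, TangentSpace 𝓘(ℝ, E) x}

theorem DiffAlongAt.eq_sum (hV : DiffAlongAt E f V x) :
    V x = ∑ i, coordAlong f V x i x • coordFrame (f x) i (f x) :=
  (eventually_eq_sum_coordAlong hV.mdifferentiableAt.continuousAt V).self_of_nhds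

theorem mvfderiv_extChartAt_apply {p q : N} (hq : q ∈ (chartAt F p).source)
    (v : TangentSpace 𝓘(ℝ, F) q) : mvfderiv 𝓘(ℝ, F) (extChartAt 𝓘(ℝ, F) p) q v
      = (trivializationAt F (TangentSpace 𝓘(ℝ, F) : N → Type _) p ⟨q, v⟩).2 := by
  have h := congrArg (fun L : F →L[ℝ] F ↦ L v)
    (TangentBundle.continuousLinearMapAt_trivializationAt (I := 𝓘(ℝ, F)) hq)
  refine h.symm.trans ?_
  exact congrFun (Trivialization.coe_linearMapAt_of_mem (R := ℝ)
    (trivializationAt F (TangentSpace 𝓘(ℝ, F) : N → Type _) p) hq) v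

/-- Coordinate vector fields commute. -/
theorem mlieBracket_extend {p : N} (v w : TangentSpace 𝓘(ℝ, F) p) :
    mlieBracket 𝓘(ℝ, F) (FiberBundle.extend F v) (FiberBundle.extend F w) p = 0 := by
  have hc : CMDiffAt 2 (extChartAt 𝓘(ℝ, F) p) p := contMDiffAt_extChartAt
  have hconst (w : TangentSpace 𝓘(ℝ, F) p) :
      (fun q ↦ mvfderiv 𝓘(ℝ, F) (extChartAt 𝓘(ℝ, F) p) q (FiberBundle.extend F w q)) =ᶠ[𝓝 p]
        fun _ ↦ (trivializationAt F (TangentSpace 𝓘(ℝ, F) : N → Type _) p ⟨p, w⟩).2 := by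
    filter_upwards [(chartAt F p).open_source.mem_nhds (mem_chart_source F p)] with q hq
    rw [mvfderiv_extChartAt_apply hq]
    exact (congrArg Prod.snd (Trivialization.apply_mk_symm
      (trivializationAt F (TangentSpace 𝓘(ℝ, F) : N → Type _) p) (b := q) hq
      (trivializationAt F (TangentSpace 𝓘(ℝ, F) : N → Type _) p ⟨p, w⟩).2) :)
  have h := mvfderiv_mlieBracket hc (FiberBundle.mdifferentiableAt_extend 𝓘(ℝ, F) F v)
    (FiberBundle.mdifferentiableAt_extend 𝓘(ℝ, F) F w)
  rw [mvfderiv_apply_congr (hconst v), mvfderiv_apply_congr (hconst w), mvfderiv_const,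
    mvfderiv_const] at h
  have h1 := congrArg (fun L : F →L[ℝ] F ↦ L (mlieBracket 𝓘(ℝ, F) (FiberBundle.extend F v)
    (FiberBundle.extend F w) p)) (mfderiv_extChartAt_self (I := 𝓘(ℝ, F)) (x := p))
  exact (h1.symm.trans h).trans (sub_self (0 : F))

/-- The components of `df(Y)` in the trivialization at `f x`. -/
theorem triv_mfderiv_eventuallyEq (hf : ContMDiff 𝓘(ℝ, E) 𝓘(ℝ, F) ∞ f) (x : M)
    (Y : Π x : M, TangentSpace 𝓘(ℝ, E) x) :
    (fun y ↦ (trivializationAt F (TangentSpace 𝓘(ℝ, F) : N → Type _) (f x)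
      ⟨f y, mfderiv 𝓘(ℝ, E) 𝓘(ℝ, F) f y (Y y)⟩).2) =ᶠ[𝓝 x]
      fun y ↦ mvfderiv 𝓘(ℝ, E) (extChartAt 𝓘(ℝ, F) (f x) ∘ f) y (Y y) := by
  filter_upwards [hf.continuous.continuousAt.preimage_mem_nhds
    ((chartAt F (f x)).open_source.mem_nhds (mem_chart_source F (f x)))] with y hy
  rw [← mvfderiv_extChartAt_apply hy]
  have h := mfderiv_comp y (mdifferentiableAt_extChartAt (I := 𝓘(ℝ, F)) hy)
    (hf.mdifferentiable (by simp) y)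
  exact (congrArg (fun L : E →L[ℝ] F ↦ L (Y y)) h).symm

theorem diffAlongAt_mfderiv (hf : ContMDiff 𝓘(ℝ, E) 𝓘(ℝ, F) ∞ f) (hY : MDiffAt (T% Y) x) :
    DiffAlongAt E f (fun y ↦ mfderiv 𝓘(ℝ, E) 𝓘(ℝ, F) f y (Y y)) x :=
  ((hf.contMDiff_tangentMap (m := ∞) (by simp)).mdifferentiable (by simp) _).comp x hY

theorem diffAlongAt_comp (hf : MDifferentiableAt 𝓘(ℝ, E) 𝓘(ℝ, F) f x)
    {Z : Π p : N, TangentSpace 𝓘(ℝ, F) p} (hZ : MDiffAt (T% Z) (f x)) :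
    DiffAlongAt E f (fun y ↦ Z (f y)) x :=
  hZ.comp x hf

variable [RiemannianBundle (fun x : N ↦ TangentSpace 𝓘(ℝ, F) x)]
  [IsContMDiffRiemannianBundle 𝓘(ℝ, F) ∞ F (fun x : N ↦ TangentSpace 𝓘(ℝ, F) x)]

/-- The pull-back connection is compatible with the metric. -/
theorem covAlong_metric (hV : DiffAlongAt E f V x) (hW : DiffAlongAt E f W x)
    (X : Π x : M, TangentSpace 𝓘(ℝ, E) x) :
    dirDeriv X (fun y ↦ inner ℝ (V y) (W y)) x
      = inner ℝ (covAlong f X V x) (W x) + inner ℝ (V x) (covAlong f X W x) := by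
  have hf := hV.mdifferentiableAt
  let g (i j : Fin (Module.finrank ℝ F)) (q : N) : ℝ :=
    inner ℝ (coordFrame (f x) i q) (coordFrame (f x) j q)
  have hg (i j) : MDiffAt (g i j) (f x) := mdifferentiableAt_inner
    (mdifferentiableAt_coordFrame (f x) i) (mdifferentiableAt_coordFrame (f x) j)
  have hgf (i j) : MDiffAt (fun y ↦ g i j (f y)) x := (hg i j).comp x hf
  have hv := hV.mdifferentiableAt_coordAlong
  have hw := hW.mdifferentiableAt_coordAlong
  have hloc : (fun y ↦ inner ℝ (V y) (W y)) =ᶠ[𝓝 x] fun y ↦ ∑ i, ∑ j,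
      (coordAlong f V x i y * coordAlong f W x j y) * g i j (f y) := by
    filter_upwards [eventually_eq_sum_coordAlong hf.continuousAt V,
      eventually_eq_sum_coordAlong hf.continuousAt W] with y h1 h2
    conv_lhs => rw [h1, h2]
    simp only [sum_inner, inner_sum, inner_smul_left, inner_smul_right, RCLike.conj_to_real, g,
      Finset.mul_sum]
    rw [Finset.sum_comm]
    exact Finset.sum_congr rfl fun i _ ↦ Finset.sum_congr rfl fun j _ ↦ by ring
  -- By the chain rule, metric compatibility is needed only on `N`, for the frame fields; the
  -- components of `V` and `W` contribute through the product rule.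
  have hdg (i j) : dirDeriv X (fun y ↦ g i j (f y)) x
      = inner ℝ (leviCivita (FiberBundle.extend F (mfderiv 𝓘(ℝ, E) 𝓘(ℝ, F) f x (X x)))
          (coordFrame (f x) i) (f x)) (coordFrame (f x) j (f x))
        + inner ℝ (coordFrame (f x) i (f x))
          (leviCivita (FiberBundle.extend F (mfderiv 𝓘(ℝ, E) 𝓘(ℝ, F) f x (X x)))
            (coordFrame (f x) j) (f x)) := by
    rw [← leviCivita_metric (FiberBundle.mdifferentiableAt_extend ..)
      (mdifferentiableAt_coordFrame (f x) i) (mdifferentiableAt_coordFrame (f x) j)]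
    have := mvfderiv_comp_apply x (hg i j) hf (X x)
    simpa [dirDeriv] using! this
  have hLHS : dirDeriv X (fun y ↦ inner ℝ (V y) (W y)) x = ∑ i, ∑ j,
      ((coordAlong f V x i x * coordAlong f W x j x) * dirDeriv X (fun y ↦ g i j (f y)) x
        + g i j (f x) * (coordAlong f V x i x * dirDeriv X (coordAlong f W x j) x
          + coordAlong f W x j x * dirDeriv X (coordAlong f V x i) x)) := by
    have : dirDeriv X (fun y ↦ inner ℝ (V y) (W y)) x = _ := mvfderiv_apply_congr hloc (X x)
    have huv (i j) : MDiffAt (fun y ↦ coordAlong f V x i y * coordAlong f W x j y) x :=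
      (hv i).mul (hw j)
    have huvg (i j) : MDiffAt (fun y ↦ (coordAlong f V x i y * coordAlong f W x j y)
        * g i j (f y)) x := (huv i j).mul (hgf i j)
    refine this.trans ((dirDeriv_sum Finset.univ fun i ↦ mdifferentiableAt_sum _
      fun j ↦ huvg i j).trans (Finset.sum_congr rfl fun i _ ↦ ?_))
    refine (dirDeriv_sum Finset.univ fun j ↦ huvg i j).trans (Finset.sum_congr rfl fun j _ ↦ ?_)
    rw [dirDeriv_mul (huv i j) (hgf i j), dirDeriv_mul (hv i) (hw j)]
  rw [hLHS, covAlong_eq_sum hV, covAlong_eq_sum hW]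
  conv_rhs =>
    enter [1, 3]
    rw [hW.eq_sum]
  conv_rhs =>
    enter [2, 2]
    rw [hV.eq_sum]
  simp only [sum_inner, inner_sum, ← Finset.sum_add_distrib]
  conv_rhs => rw [Finset.sum_comm]
  refine Finset.sum_congr rfl fun i _ ↦ Finset.sum_congr rfl fun j _ ↦ ?_
  rw [hdg]
  simp only [inner_add_left, inner_add_right, inner_smul_left, inner_smul_right,
    RCLike.conj_to_real, g]
  ring

/-- The pull-back connection is torsion-free. -/
theorem covAlong_torsionFree (hf : ContMDiff 𝓘(ℝ, E) 𝓘(ℝ, F) ∞ f) (hX : MDiffAt (T% X) x)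
    (hY : MDiffAt (T% Y) x) :
    covAlong f X (fun y ↦ mfderiv 𝓘(ℝ, E) 𝓘(ℝ, F) f y (Y y)) x
      - covAlong f Y (fun y ↦ mfderiv 𝓘(ℝ, E) 𝓘(ℝ, F) f y (X y)) x
      = mfderiv 𝓘(ℝ, E) 𝓘(ℝ, F) f x (mlieBracket 𝓘(ℝ, E) X Y x) := by
  have hc : CMDiffAt 2 (extChartAt 𝓘(ℝ, F) (f x) ∘ f) x :=
    (contMDiffAt_extChartAt (n := 2)).comp x ((hf x).of_le ENat.LEInfty.out)
  have hb : f x ∈ (trivializationAt F (TangentSpace 𝓘(ℝ, F) : N → Type _) (f x)).baseSet :=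
    FiberBundle.mem_baseSet_trivializationAt' (f x)
  -- Coordinate fields commute, so the Christoffel terms of the two covariant derivatives agree and
  -- cancel. What remains is the commutator identity for the chart expression of `f`.
  have hsymm := leviCivita_torsionFree
    (FiberBundle.mdifferentiableAt_extend 𝓘(ℝ, F) F (mfderiv 𝓘(ℝ, E) 𝓘(ℝ, F) f x (X x)))
    (FiberBundle.mdifferentiableAt_extend 𝓘(ℝ, F) F (mfderiv 𝓘(ℝ, E) 𝓘(ℝ, F) f x (Y x)))
  rw [mlieBracket_extend, sub_eq_zero] at hsymm
  have hbr := (triv_mfderiv_eventuallyEq hf x (mlieBracket 𝓘(ℝ, E) X Y)).self_of_nhds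
  dsimp only at hbr
  simp only [covAlong]
  rw [hsymm, add_sub_add_right_eq_sub,
    mvfderiv_apply_congr (triv_mfderiv_eventuallyEq hf x X),
    mvfderiv_apply_congr (triv_mfderiv_eventuallyEq hf x Y),
    ← Trivialization.coe_symmₗ (R := ℝ) _ hb, ← map_sub, ← mvfderiv_mlieBracket hc hX hY, ← hbr,
    Trivialization.coe_symmₗ (R := ℝ) _ hb]
  exact Trivialization.symm_apply_apply_mk _ hb _

/-- `covAlong` sees `X` only through `X x`, so pointwise linearity holds for arbitrary, even
non-smooth, `X`. -/
theorem exists_continuousLinearMap_covAlong (hV : DiffAlongAt E f V x) :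
    ∃ L : TangentSpace 𝓘(ℝ, E) x →L[ℝ] TangentSpace 𝓘(ℝ, F) (f x),
      ∀ X : Π x : M, TangentSpace 𝓘(ℝ, E) x, covAlong f X V x = L (X x) := by
  refine ⟨∑ i, ((mvfderiv 𝓘(ℝ, E) (coordAlong f V x i) x).smulRight (coordFrame (f x) i (f x))
    + coordAlong f V x i x • (TensorialAt.mkHom _ _ (tensorialAt_leviCivita
      (mdifferentiableAt_coordFrame (f x) i))).comp (mfderiv 𝓘(ℝ, E) 𝓘(ℝ, F) f x)), fun X ↦ ?_⟩
  rw [covAlong_eq_sum hV]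
  simp [TensorialAt.mkHom_apply_eq_extend, dirDeriv]

/-- For the restriction of a field on `N`, the chain rule applied to the components recovers the
connection of `N`. This transports `∇̄ξ_i` to the submanifold. -/
theorem covAlong_comp (hf : MDifferentiableAt 𝓘(ℝ, E) 𝓘(ℝ, F) f x)
    {Z : Π p : N, TangentSpace 𝓘(ℝ, F) p} (hZ : MDiffAt (T% Z) (f x)) :
    covAlong f X (fun y ↦ Z (f y)) x
      = leviCivita (FiberBundle.extend F (mfderiv 𝓘(ℝ, E) 𝓘(ℝ, F) f x (X x))) Z (f x) := by
  have hid : DiffAlongAt F (fun q : N ↦ q) Z (f x) := hZ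
  have hA := FiberBundle.mdifferentiableAt_extend 𝓘(ℝ, F) F (mfderiv 𝓘(ℝ, E) 𝓘(ℝ, F) f x (X x))
  have hc := hid.mdifferentiableAt_coordAlong
  rw [covAlong_eq_sum (diffAlongAt_comp hf hZ)]
  have hZ' : MDiffAt (T% (fun q ↦ ∑ i, coordAlong (fun q : N ↦ q) Z (f x) i q •
      coordFrame (f x) i q)) (f x) :=
    .sum_section fun i _ ↦ (hc i).smul_section (mdifferentiableAt_coordFrame (f x) i)
  refine Eq.trans ?_ (leviCivita_congr_right (E := F) hA hZ hZ'
    (eventually_eq_sum_coordAlong (f := fun q : N ↦ q) continuousAt_id Z)).symm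
  refine Eq.trans ?_ (leviCivita_sum_smul Finset.univ hA hc
    (mdifferentiableAt_coordFrame (f x))).symm
  refine Finset.sum_congr rfl fun i _ ↦ ?_
  rw [add_comm]
  congr 2
  have := mvfderiv_comp_apply x (hc i) hf (X x)
  simpa [dirDeriv] using! this

theorem covAlong_zero (hf : MDifferentiableAt 𝓘(ℝ, E) 𝓘(ℝ, F) f x) :
    covAlong f X (fun y ↦ (0 : TangentSpace 𝓘(ℝ, F) (f y))) x = 0 := by
  have h0 : MDiffAt (T% (0 : Π p : N, TangentSpace 𝓘(ℝ, F) p)) (f x) :=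
    mdifferentiableAt_zeroSection ..
  exact (covAlong_comp hf h0).trans (leviCivita_zero (FiberBundle.mdifferentiableAt_extend ..))

end AlongRules

/-! ### Lie derivatives along the structure fields and the formula for `∇̄ξ_i`. -/

namespace MetricFStructure

variable {E : Type*} [NormedAddCommGroup E] [NormedSpace ℝ E] [FiniteDimensional ℝ E]
  {M : Type*} [TopologicalSpace M] [ChartedSpace E M] [IsManifold 𝓘(ℝ, E) ∞ M]
  [RiemannianBundle (fun x : M ↦ TangentSpace 𝓘(ℝ, E) x)]
  [IsContMDiffRiemannianBundle 𝓘(ℝ, E) ∞ E (fun x : M ↦ TangentSpace 𝓘(ℝ, E) x)]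
  {s n : ℕ} {S : MetricFStructure E M s} {X Y Z : Π x : M, TangentSpace 𝓘(ℝ, E) x}

theorem isSmoothVF_φ (S : MetricFStructure E M s) (hY : IsSmoothVF Y) :
    IsSmoothVF (fun y ↦ S.φ y (Y y)) :=
  S.smooth_φ.clm_bundle_apply hY

theorem contMDiff_η (S : MetricFStructure E M s) (k : Fin s) (hY : IsSmoothVF Y) :
    CMDiff ∞ (fun y ↦ S.η k y (Y y)) := by
  simp only [S.η_eq]
  exact hY.contMDiff_inner (S.smooth_ξ k)

/-- The structure forms are invariant under the flows of the structure vector fields. -/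
theorem dirDeriv_ξ_η (hS : S.IsGeneralizedAlmostKenmotsu n) (i k : Fin s) (hY : IsSmoothVF Y)
    (x : M) : dirDeriv (S.ξ i) (fun y ↦ S.η k y (Y y)) x
      = S.η k x (mlieBracket 𝓘(ℝ, E) (S.ξ i) Y x) := by
  have h := hS.closed k _ _ (S.smooth_ξ i) hY x
  have h0 : dirDeriv Y (fun y ↦ S.η k y (S.ξ i y)) x = 0 := by
    simp [S.η_ξ, dirDeriv, mvfderiv_const]
  rw [extDerivOne, h0] at h
  linarith

/-- `φ` is invariant under the flows of the structure vector fields. -/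
theorem mlieBracket_ξ_φ (hS : S.IsGeneralizedKenmotsu n) (i : Fin s) (hY : IsSmoothVF Y)
    (x : M) : mlieBracket 𝓘(ℝ, E) (S.ξ i) (fun y ↦ S.φ y (Y y)) x
      = S.φ x (mlieBracket 𝓘(ℝ, E) (S.ξ i) Y x) := by
  have h := hS.normal _ _ (S.smooth_ξ i) hY x
  have hφξ : (fun y ↦ S.φ y (S.ξ i y)) = 0 := funext fun y ↦ S.φ_ξ i y
  simp only [nijenhuis, hφξ, hS.closed _ _ _ (S.smooth_ξ i) hY x, mlieBracket_zero_left,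
    Pi.zero_apply, map_zero, zero_smul, Finset.sum_const_zero, smul_zero, add_zero, sub_zero]
    at h
  have hη (k : Fin s) :
      S.η k x (mlieBracket 𝓘(ℝ, E) (S.ξ i) (fun y ↦ S.φ y (Y y)) x) = 0 := by
    rw [← dirDeriv_ξ_η hS.toIsGeneralizedAlmostKenmotsu i k (S.isSmoothVF_φ hY) x]
    simp [S.η_φ, dirDeriv, mvfderiv_const]
  -- Let `w = φ[ξ, Y] - [ξ, φY]`. Normality says `φ w = 0` and every `η k` kills `w`, so `φ² w = -w
  -- + ∑ η^k(w) ξ_k` forces `w = 0`.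
  have hw := S.φ_φ x (S.φ x (mlieBracket 𝓘(ℝ, E) (S.ξ i) Y x)
    - mlieBracket 𝓘(ℝ, E) (S.ξ i) (fun y ↦ S.φ y (Y y)) x)
  simp only [map_sub, h, hη, S.η_φ, sub_zero, zero_smul, Finset.sum_const_zero, add_zero,
    map_zero] at hw
  rw [eq_comm, neg_eq_zero, sub_eq_zero] at hw
  exact hw.symm

/-- This is `L_ξ Φ = 2Φ`: since `Φ(ξ_i, ·) = 0`, only the Lie derivative terms of `dΦ(ξ_i, Y, Z)`
survive, and only the term with `η^i(ξ_i) = 1` in the wedge product. -/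
theorem dirDeriv_ξ_inner_φ (hS : S.IsGeneralizedAlmostKenmotsu n) (i : Fin s)
    (hY : IsSmoothVF Y) (hZ : IsSmoothVF Z) (x : M) :
    dirDeriv (S.ξ i) (fun y ↦ inner ℝ (Y y) (S.φ y (Z y))) x
      = inner ℝ (mlieBracket 𝓘(ℝ, E) (S.ξ i) Y x) (S.φ x (Z x))
        + inner ℝ (Y x) (S.φ x (mlieBracket 𝓘(ℝ, E) (S.ξ i) Z x))
        + 2 * inner ℝ (Y x) (S.φ x (Z x)) := by
  have h := hS.dΦ _ _ _ (S.smooth_ξ i) hY hZ x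
  have hξ (y : M) (v : TangentSpace 𝓘(ℝ, E) y) : inner ℝ (S.ξ i y) (S.φ y v) = 0 := by
    rw [S.skew, S.φ_ξ, inner_zero_left, neg_zero]
  have h0 (X : Π x : M, TangentSpace 𝓘(ℝ, E) x) : dirDeriv X (fun _ ↦ (0 : ℝ)) x = 0 := by
    simp [dirDeriv, mvfderiv_const]
  simp only [extDerivTwo, wedgeOneTwo, Φ, S.φ_ξ, inner_zero_right, hξ, h0, S.η_ξ, mul_zero,
    add_zero, sub_zero, ite_mul, one_mul, zero_mul, mul_ite, Finset.sum_ite_eq',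
    Finset.mem_univ, if_true] at h
  rw [mlieBracket_swap_apply (V := Z), inner_neg_left, S.skew x _ (Y x),
    real_inner_comm (Y x)] at h
  linarith

/-- The Lie derivative of the metric along a structure vector field. -/
theorem dirDeriv_ξ_inner (hS : S.IsGeneralizedKenmotsu n) (i : Fin s)
    (hY : IsSmoothVF Y) (hZ : IsSmoothVF Z) (x : M) :
    dirDeriv (S.ξ i) (fun y ↦ inner ℝ (Y y) (Z y)) x
      = inner ℝ (mlieBracket 𝓘(ℝ, E) (S.ξ i) Y x) (Z x)
        + inner ℝ (Y x) (mlieBracket 𝓘(ℝ, E) (S.ξ i) Z x)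
        + 2 * (inner ℝ (Y x) (Z x) - ∑ k, S.η k x (Y x) * S.η k x (Z x)) := by
  -- Using `φZ` as second argument turns `Φ` into the metric, since `g(Y, φ²Z) = ∑ η^k(Y) η^k(Z) -
  -- g(Y, Z)`.
  have h := dirDeriv_ξ_inner_φ hS.toIsGeneralizedAlmostKenmotsu i hY (S.isSmoothVF_φ hZ) x
  rw [mlieBracket_ξ_φ hS i hZ] at h
  have hexp (y : M) (v w : TangentSpace 𝓘(ℝ, E) y) : inner ℝ v (S.φ y (S.φ y w))
      = ∑ k, S.η k y v * S.η k y w - inner ℝ v w := by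
    rw [S.skew, S.inner_φ_φ]
    ring
  simp only [hexp] at h
  have hdY (k : Fin s) : MDiffAt (fun y ↦ S.η k y (Y y)) x :=
    (S.contMDiff_η k hY x).mdifferentiableAt (by simp)
  have hdZ (k : Fin s) : MDiffAt (fun y ↦ S.η k y (Z y)) x :=
    (S.contMDiff_η k hZ x).mdifferentiableAt (by simp)
  have hdYZ (k : Fin s) : MDiffAt (fun y ↦ S.η k y (Y y) * S.η k y (Z y)) x :=
    (hdY k).mul (hdZ k)
  have hL : dirDeriv (S.ξ i)
      (fun y ↦ ∑ k, S.η k y (Y y) * S.η k y (Z y) - inner ℝ (Y y) (Z y)) x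
      = ∑ k, (S.η k x (Y x) * S.η k x (mlieBracket 𝓘(ℝ, E) (S.ξ i) Z x)
          + S.η k x (mlieBracket 𝓘(ℝ, E) (S.ξ i) Y x) * S.η k x (Z x))
        - dirDeriv (S.ξ i) (fun y ↦ inner ℝ (Y y) (Z y)) x := by
    have hsub : dirDeriv (S.ξ i)
        (fun y ↦ ∑ k, S.η k y (Y y) * S.η k y (Z y) - inner ℝ (Y y) (Z y)) x
        = dirDeriv (S.ξ i) (fun y ↦ ∑ k, S.η k y (Y y) * S.η k y (Z y)) x
          - dirDeriv (S.ξ i) (fun y ↦ inner ℝ (Y y) (Z y)) x := by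
      simp only [dirDeriv]
      rw [mvfderiv_fun_sub (mdifferentiableAt_sum _ hdYZ)
        (mdifferentiableAt_inner (hY.mdifferentiableAt x) (hZ.mdifferentiableAt x))]
      rfl
    rw [hsub, dirDeriv_sum _ hdYZ]
    congr 1
    refine Finset.sum_congr rfl fun k _ ↦ ?_
    rw [dirDeriv_mul (hdY k) (hdZ k), dirDeriv_ξ_η hS.toIsGeneralizedAlmostKenmotsu i k hY,
      dirDeriv_ξ_η hS.toIsGeneralizedAlmostKenmotsu i k hZ]
    ring
  rw [hL, Finset.sum_add_distrib] at h
  linarith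

/-- The Koszul expression for `ξ_i` is half of `L_ξ g` plus the term `dη^i(X, Z)`, and the latter
vanishes by closedness. -/
theorem koszul_ξ (hS : S.IsGeneralizedKenmotsu n) (i : Fin s)
    (hX : IsSmoothVF X) (hZ : IsSmoothVF Z) (x : M) :
    koszul X (S.ξ i) Z x = inner ℝ (X x) (Z x) - ∑ k, S.η k x (X x) * S.η k x (Z x) := by
  have hc := hS.closed i _ _ hX hZ x
  have hL := dirDeriv_ξ_inner hS i hX hZ x
  have hη (y : M) (v : TangentSpace 𝓘(ℝ, E) y) : inner ℝ (S.ξ i y) v = S.η i y v := by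
    rw [S.η_eq, real_inner_comm]
  rw [extDerivOne] at hc
  simp only [koszul, hη, ← S.η_eq]
  rw [hL, mlieBracket_swap_apply (V := X) (W := S.ξ i), inner_neg_left,
    real_inner_comm (X x) (mlieBracket 𝓘(ℝ, E) (S.ξ i) Z x)]
  linarith

/-- `∇_X ξ_i = -φ² X`. -/
theorem leviCivita_ξ [T2Space M] (hS : S.IsGeneralizedKenmotsu n) (i : Fin s) {x : M}
    (hX : MDiffAt (T% X) x) :
    leviCivita X (S.ξ i) x = X x - ∑ k, S.η k x (X x) • S.ξ k x := by
  -- The structure equations are available only for global smooth fields; tensoriality in `X` allows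
  -- the replacement.
  obtain ⟨X', hX', hXX'⟩ := exists_isSmoothVF_eq (X x)
  rw [leviCivita_congr_left hX (hX'.mdifferentiableAt x) ((S.smooth_ξ i).mdifferentiableAt x)
    hXX'.symm]
  refine ext_inner_right ℝ fun z ↦ ?_
  obtain ⟨Z, hZ, rfl⟩ := exists_isSmoothVF_eq z
  rw [inner_leviCivita (hX'.mdifferentiableAt x) ((S.smooth_ξ i).mdifferentiableAt x)
    (hZ.mdifferentiableAt x), koszul_ξ hS i hX' hZ, hXX', inner_sub_left, sum_inner]
  congr 1
  refine Finset.sum_congr rfl fun k _ ↦ ?_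
  rw [inner_smul_left, S.η_eq k x (Z x), real_inner_comm (S.ξ k x)]
  rfl

end MetricFStructure

/-! ### Gauss formula, second fundamental form, and the easy implication. -/

section Submanifold

variable {E F : Type*} [NormedAddCommGroup E] [NormedSpace ℝ E] [FiniteDimensional ℝ E]
  [NormedAddCommGroup F] [NormedSpace ℝ F] [FiniteDimensional ℝ F]
  {M : Type*} [TopologicalSpace M] [ChartedSpace E M] [IsManifold 𝓘(ℝ, E) ∞ M]
  [RiemannianBundle (fun x : M ↦ TangentSpace 𝓘(ℝ, E) x)]
  [IsContMDiffRiemannianBundle 𝓘(ℝ, E) ∞ E (fun x : M ↦ TangentSpace 𝓘(ℝ, E) x)]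
  {N : Type*} [TopologicalSpace N] [ChartedSpace F N] [IsManifold 𝓘(ℝ, F) ∞ N]
  [RiemannianBundle (fun x : N ↦ TangentSpace 𝓘(ℝ, F) x)]
  [IsContMDiffRiemannianBundle 𝓘(ℝ, F) ∞ F (fun x : N ↦ TangentSpace 𝓘(ℝ, F) x)]
  {f : M → N} {x : M} {X Y Z : Π x : M, TangentSpace 𝓘(ℝ, E) x}

/-- The Gauss formula: the Levi-Civita connection of `M` is the tangential part of that of `N`. -/
theorem IsIsometricImmersion.inner_leviCivita (hf : IsIsometricImmersion E F f)
    (hX : MDiffAt (T% X) x) (hY : MDiffAt (T% Y) x) (hZ : MDiffAt (T% Z) x) :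
    inner ℝ (leviCivita X Y x) (Z x)
      = inner ℝ (covAlong f X (fun y ↦ mfderiv 𝓘(ℝ, E) 𝓘(ℝ, F) f y (Y y)) x)
        (mfderiv 𝓘(ℝ, E) 𝓘(ℝ, F) f x (Z x)) := by
  have hdX := diffAlongAt_mfderiv hf.smooth hX
  have hdY := diffAlongAt_mfderiv hf.smooth hY
  have hdZ := diffAlongAt_mfderiv hf.smooth hZ
  -- The pull-back connection is metric and torsion-free, so the Koszul computation can be run with
  -- it; the isometry identifies the two Koszul expressions.
  have h1 := covAlong_metric hdY hdZ X
  have h2 := covAlong_metric hdX hdZ Y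
  have h3 := covAlong_metric hdX hdY Z
  have t1 := covAlong_torsionFree hf.smooth hX hY
  have t2 := covAlong_torsionFree hf.smooth hX hZ
  have t3 := covAlong_torsionFree hf.smooth hY hZ
  rw [GenKenmotsu.inner_leviCivita hX hY hZ]
  simp only [koszul, ← hf.isometric]
  rw [h1, h2, h3, ← t1, ← t2, ← t3]
  simp only [inner_sub_left]
  rw [real_inner_comm (covAlong f X (fun y ↦ mfderiv 𝓘(ℝ, E) 𝓘(ℝ, F) f y (Z y)) x),
    real_inner_comm (covAlong f Y (fun y ↦ mfderiv 𝓘(ℝ, E) 𝓘(ℝ, F) f y (Z y)) x),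
    real_inner_comm (covAlong f Z (fun y ↦ mfderiv 𝓘(ℝ, E) 𝓘(ℝ, F) f y (Y y)) x)]
  ring

theorem normalPart_mfderiv (f : M → N) (x : M) (v : TangentSpace 𝓘(ℝ, E) x) :
    normalPart (E := E) f x (mfderiv 𝓘(ℝ, E) 𝓘(ℝ, F) f x v) = 0 :=
  Submodule.starProjection_orthogonal_apply_eq_zero ⟨v, rfl⟩

/-- The antisymmetric part of `∇̄_X Y` is `df [X, Y]`, which has no normal component. -/
theorem secondFundamentalForm_symm (hf : ContMDiff 𝓘(ℝ, E) 𝓘(ℝ, F) ∞ f)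
    (hX : MDiffAt (T% X) x) (hY : MDiffAt (T% Y) x) :
    secondFundamentalForm (F := F) f X Y x = secondFundamentalForm f Y X x := by
  have h := congrArg (normalPart (E := E) f x) (covAlong_torsionFree hf hX hY)
  rw [normalPart_mfderiv, normalPart, map_sub, sub_eq_zero] at h
  exact h

theorem exists_linearMap_secondFundamentalForm (hf : ContMDiff 𝓘(ℝ, E) 𝓘(ℝ, F) ∞ f)
    (hY : MDiffAt (T% Y) x) :
    ∃ L : TangentSpace 𝓘(ℝ, E) x →ₗ[ℝ] TangentSpace 𝓘(ℝ, F) (f x),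
      ∀ X : Π x : M, TangentSpace 𝓘(ℝ, E) x, secondFundamentalForm f X Y x = L (X x) := by
  obtain ⟨L, hL⟩ := exists_continuousLinearMap_covAlong (diffAlongAt_mfderiv hf hY)
  refine ⟨(tangentImage (E := E) f x)ᗮ.starProjection.toLinearMap ∘ₗ L.toLinearMap, fun X ↦ ?_⟩
  rw [secondFundamentalForm, hL, normalPart]
  rfl

theorem normalConnection_zero (hf : ContMDiff 𝓘(ℝ, E) 𝓘(ℝ, F) ∞ f)
    (X : Π x : M, TangentSpace 𝓘(ℝ, E) x) :
    normalConnection f X (fun y ↦ (0 : TangentSpace 𝓘(ℝ, F) (f y))) = fun _ ↦ 0 := by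
  ext x
  rw [normalConnection, covAlong_zero (hf.mdifferentiable (by simp) x), normalPart, map_zero]

theorem normalCurvature_zero (hf : ContMDiff 𝓘(ℝ, E) 𝓘(ℝ, F) ∞ f)
    (X Y : Π x : M, TangentSpace 𝓘(ℝ, E) x) (x : M) :
    normalCurvature f X Y (fun y ↦ (0 : TangentSpace 𝓘(ℝ, F) (f y))) x = 0 := by
  simp [normalCurvature, normalConnection_zero hf]

/-- `h = 0` is assumed on smooth fields only, so the point is that `∇` and `R` produce smooth
fields; then `∇̄h` and every term of the action vanish. -/
theorem IsTotallyGeodesic.isTwoSemiparallel [T2Space M] (hf : ContMDiff 𝓘(ℝ, E) 𝓘(ℝ, F) ∞ f)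
    (h : IsTotallyGeodesic E F f) : IsTwoSemiparallel E F f := by
  have hcov (Z U V : Π x : M, TangentSpace 𝓘(ℝ, E) x) (hZ : IsSmoothVF Z) (hU : IsSmoothVF U)
      (hV : IsSmoothVF V) : covSecondFundamentalForm (F := F) f Z U V = fun _ ↦ 0 := by
    ext x
    have h0 : secondFundamentalForm (F := F) f U V = fun _ ↦ 0 := funext (h U V hU hV)
    rw [covSecondFundamentalForm, h0, normalConnection_zero hf, h _ _ (hZ.leviCivita hU) hV,
      h _ _ hU (hZ.leviCivita hV)]
    simp
  intro X Y Z U V hX hY hZ hU hV x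
  rw [curvatureActionOnCovSFF, hcov Z U V hZ hU hV, normalCurvature_zero hf,
    hcov _ U V (hX.curvature hY hZ) hU hV, hcov Z _ V hZ (hX.curvature hY hU) hV,
    hcov Z U _ hZ hU (hX.curvature hY hV)]
  simp

end Submanifold

/-! ### Structure fields on an invariant submanifold and the main argument. -/

namespace IsInvariantSubmanifold

variable {E F : Type*} [NormedAddCommGroup E] [NormedSpace ℝ E] [FiniteDimensional ℝ E]
  [NormedAddCommGroup F] [NormedSpace ℝ F] [FiniteDimensional ℝ F]
  {M : Type*} [TopologicalSpace M] [ChartedSpace E M] [IsManifold 𝓘(ℝ, E) ∞ M]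
  [RiemannianBundle (fun x : M ↦ TangentSpace 𝓘(ℝ, E) x)]
  {N : Type*} [TopologicalSpace N] [ChartedSpace F N] [IsManifold 𝓘(ℝ, F) ∞ N]
  [RiemannianBundle (fun x : N ↦ TangentSpace 𝓘(ℝ, F) x)]
  {f : M → N} {x : M} {X Y Z : Π x : M, TangentSpace 𝓘(ℝ, E) x}
  {n s : ℕ} {S : MetricFStructure F N s}

/-- The structure vector fields, as vector fields on the submanifold. -/
def ξ (hf : IsInvariantSubmanifold E S f) (i : Fin s) (x : M) : TangentSpace 𝓘(ℝ, E) x :=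
  (hf.ξ_mem i x).choose

/-- The projection onto the orthogonal complement of the structure vector fields. -/
def horizontal (hf : IsInvariantSubmanifold E S f) (x : M) :
    TangentSpace 𝓘(ℝ, E) x →L[ℝ] TangentSpace 𝓘(ℝ, E) x :=
  ContinuousLinearMap.id ℝ _ - ∑ k, (innerSL ℝ (hf.ξ k x)).smulRight (hf.ξ k x)

variable (hf : IsInvariantSubmanifold E S f)

theorem mfderiv_ξ (i : Fin s) (x : M) :
    mfderiv 𝓘(ℝ, E) 𝓘(ℝ, F) f x (hf.ξ i x) = S.ξ i (f x) :=
  (hf.ξ_mem i x).choose_spec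

theorem horizontal_apply (x : M) (v : TangentSpace 𝓘(ℝ, E) x) :
    hf.horizontal x v = v - ∑ k, inner ℝ v (hf.ξ k x) • hf.ξ k x := by
  simp [horizontal, real_inner_comm v]

theorem inner_ξ_ξ (i k : Fin s) (x : M) :
    inner ℝ (hf.ξ i x) (hf.ξ k x) = if k = i then 1 else 0 := by
  rw [← hf.isometric, hf.mfderiv_ξ, hf.mfderiv_ξ, ← S.η_eq, S.η_ξ]

theorem horizontal_ξ (i : Fin s) (x : M) : hf.horizontal x (hf.ξ i x) = 0 := by
  simp [horizontal_apply, inner_ξ_ξ]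

variable [IsContMDiffRiemannianBundle 𝓘(ℝ, E) ∞ E (fun x : M ↦ TangentSpace 𝓘(ℝ, E) x)]
  [IsContMDiffRiemannianBundle 𝓘(ℝ, F) ∞ F (fun x : N ↦ TangentSpace 𝓘(ℝ, F) x)]

/-- The `ξ i` on `M` are chosen pointwise, so smoothness is read off from inner products, which the
isometry computes in `N`. -/
theorem isSmoothVF_ξ [T2Space M] (i : Fin s) : IsSmoothVF (hf.ξ i) := by
  refine isSmoothVF_of_inner fun Z hZ ↦ ?_
  simp only [← hf.isometric, hf.mfderiv_ξ]
  exact ContMDiff.inner_bundle (F := F) (E := fun x : N ↦ TangentSpace 𝓘(ℝ, F) x) (b := f)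
    (v := fun y ↦ S.ξ i (f y)) (w := fun y ↦ mfderiv 𝓘(ℝ, E) 𝓘(ℝ, F) f y (Z y))
    ((S.smooth_ξ i).comp hf.smooth)
    ((hf.smooth.contMDiff_tangentMap (m := ∞) (by simp)).comp hZ)

variable [T2Space N]

theorem covAlong_ξ (hS : S.IsGeneralizedKenmotsu n) (i : Fin s)
    (X : Π x : M, TangentSpace 𝓘(ℝ, E) x) (x : M) :
    covAlong f X (fun y ↦ mfderiv 𝓘(ℝ, E) 𝓘(ℝ, F) f y (hf.ξ i y)) x
      = mfderiv 𝓘(ℝ, E) 𝓘(ℝ, F) f x (hf.horizontal x (X x)) := by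
  simp only [hf.mfderiv_ξ]
  rw [covAlong_comp (hf.smooth.mdifferentiable (by simp) x)
    ((S.smooth_ξ i).mdifferentiableAt (f x)),
    MetricFStructure.leviCivita_ξ hS i (FiberBundle.mdifferentiableAt_extend ..),
    FiberBundle.extend_apply_self, horizontal_apply, map_sub, map_sum]
  congr 1
  refine Finset.sum_congr rfl fun k _ ↦ ?_
  rw [map_smul, hf.mfderiv_ξ, S.η_eq, ← hf.isometric, hf.mfderiv_ξ]

/-- `∇̄_X ξ_i` is tangent to `M`. The identity is one of fields, not of values at a point, because
the normal connection will differentiate it. -/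
theorem secondFundamentalForm_ξ (hS : S.IsGeneralizedKenmotsu n) (i : Fin s)
    (X : Π x : M, TangentSpace 𝓘(ℝ, E) x) :
    secondFundamentalForm (F := F) f X (hf.ξ i) = fun _ ↦ 0 := by
  ext x
  rw [secondFundamentalForm, hf.covAlong_ξ hS, normalPart_mfderiv]

variable [T2Space M]

theorem secondFundamentalForm_ξ_left (hS : S.IsGeneralizedKenmotsu n) (i : Fin s)
    (hX : IsSmoothVF X) : secondFundamentalForm (F := F) f (hf.ξ i) X = fun _ ↦ 0 := by
  ext x
  rw [secondFundamentalForm_symm hf.smooth ((hf.isSmoothVF_ξ i).mdifferentiableAt x)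
    (hX.mdifferentiableAt x), hf.secondFundamentalForm_ξ hS]

theorem leviCivita_ξ (hS : S.IsGeneralizedKenmotsu n) (i : Fin s) (hX : IsSmoothVF X) :
    leviCivita X (hf.ξ i) = fun x ↦ hf.horizontal x (X x) := by
  ext x
  refine eq_of_forall_inner_eq fun Z hZ ↦ ?_
  rw [hf.toIsIsometricImmersion.inner_leviCivita (hX.mdifferentiableAt x)
    ((hf.isSmoothVF_ξ i).mdifferentiableAt x) hZ, hf.covAlong_ξ hS, hf.isometric]

/-- `X` and its horizontal part differ by a combination of the `ξ k`, which `h` annihilates. -/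
theorem secondFundamentalForm_horizontal (hS : S.IsGeneralizedKenmotsu n) (hY : IsSmoothVF Y)
    (X : Π x : M, TangentSpace 𝓘(ℝ, E) x) (x : M) :
    secondFundamentalForm (F := F) f (fun y ↦ hf.horizontal y (X y)) Y x
      = secondFundamentalForm f X Y x := by
  obtain ⟨L, hL⟩ := exists_linearMap_secondFundamentalForm hf.smooth (hY.mdifferentiableAt x)
  have h0 (k : Fin s) : L (hf.ξ k x) = 0 := by
    rw [← hL, hf.secondFundamentalForm_ξ_left hS k hY]
  rw [hL, hL, horizontal_apply, map_sub, map_sum]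
  simp [h0]

/-- `R(X, ξ_i) ξ_i = φ² X`. -/
theorem curvature_ξ_ξ (hS : S.IsGeneralizedKenmotsu n) (i : Fin s) (hX : IsSmoothVF X) :
    curvature X (hf.ξ i) (hf.ξ i)
      = fun x ↦ -hf.horizontal x (hf.horizontal x (X x)) := by
  ext x
  have hξ := hf.isSmoothVF_ξ
  have hξξ (k : Fin s) : leviCivita (hf.ξ i) (hf.ξ k) = 0 := by
    rw [hf.leviCivita_ξ hS k (hξ i)]
    ext y
    exact hf.horizontal_ξ i y
  have hu (k : Fin s) : MDiffAt (fun y ↦ -inner ℝ (X y) (hf.ξ k y)) x :=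
    (mdifferentiableAt_inner (hX.mdifferentiableAt x) ((hξ k).mdifferentiableAt x)).neg
  have hdu (k : Fin s) : dirDeriv (hf.ξ i) (fun y ↦ -inner ℝ (X y) (hf.ξ k y)) x
      = -inner ℝ (leviCivita (hf.ξ i) X x) (hf.ξ k x) := by
    have h := leviCivita_metric ((hξ i).mdifferentiableAt x) (hX.mdifferentiableAt x)
      ((hξ k).mdifferentiableAt x)
    rw [hξξ k, Pi.zero_apply, inner_zero_right, add_zero] at h
    rw [← h, dirDeriv, mvfderiv_fun_neg]
    rfl
  have hsplit : (fun y ↦ hf.horizontal y (X y))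
      = X + fun y ↦ ∑ k, (-inner ℝ (X y) (hf.ξ k y)) • hf.ξ k y := by
    ext y
    simp [horizontal_apply, sub_eq_add_neg]
  have hsum : MDiffAt (T% (fun y ↦ ∑ k, (-inner ℝ (X y) (hf.ξ k y)) • hf.ξ k y)) x :=
    .sum_section fun k _ ↦ (hu k).smul_section ((hξ k).mdifferentiableAt x)
  -- The fields `ξ k` are parallel along `ξ i`, so `∇_{ξ_i}` commutes with the horizontal
  -- projection.
  have h2 : leviCivita (hf.ξ i) (fun y ↦ hf.horizontal y (X y)) x
      = hf.horizontal x (leviCivita (hf.ξ i) X x) := by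
    rw [hsplit, leviCivita_add ((hξ i).mdifferentiableAt x) (hX.mdifferentiableAt x) hsum,
      leviCivita_sum_smul _ ((hξ i).mdifferentiableAt x) hu fun k ↦ (hξ k).mdifferentiableAt x,
      horizontal_apply]
    simp only [hdu, hξξ, Pi.zero_apply, smul_zero, zero_add, neg_smul, Finset.sum_neg_distrib]
    rw [sub_eq_add_neg]
  have h3 : mlieBracket 𝓘(ℝ, E) X (hf.ξ i) x
      = hf.horizontal x (X x) - leviCivita (hf.ξ i) X x := by
    rw [← leviCivita_torsionFree (hX.mdifferentiableAt x) ((hξ i).mdifferentiableAt x),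
      hf.leviCivita_ξ hS i hX]
  -- With `P` the horizontal projection, the three curvature terms are `0`, `-P∇_ξ X` and `-P(PX -
  -- ∇_ξ X)`, whose sum is `-P(PX)`.
  rw [curvature, hξξ, leviCivita_zero (hX.mdifferentiableAt x), hf.leviCivita_ξ hS i hX, h2,
    hf.leviCivita_ξ hS i (hX.mlieBracket (hξ i))]
  dsimp only
  rw [h3, map_sub]
  abel

theorem isTotallyGeodesic_of_isTwoSemiparallel (hf : IsInvariantSubmanifold E S f)
    (hS : S.IsGeneralizedKenmotsu n)
    (h : IsTwoSemiparallel E F f) : IsTotallyGeodesic E F f := by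
  intro X Z hX hZ x
  -- A structure field exists because `s ≥ 1`; a single one suffices.
  let i : Fin s := ⟨0, hS.one_le⟩
  have hξ := hf.isSmoothVF_ξ i
  have hW := hX.curvature hξ hξ
  have hB := hZ.leviCivita hξ
  have hcov (A : Π x : M, TangentSpace 𝓘(ℝ, E) x) (hA : IsSmoothVF A) :
      covSecondFundamentalForm (F := F) f A (hf.ξ i) (hf.ξ i) = fun _ ↦ 0 := by
    ext y
    rw [covSecondFundamentalForm, hf.secondFundamentalForm_ξ hS, hf.secondFundamentalForm_ξ hS,
      hf.secondFundamentalForm_ξ_left hS i (hA.leviCivita hξ), normalConnection_zero hf.smooth]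
    simp
  -- Here `∇_Z ξ = PZ` and `R(X, ξ)ξ = -P(PX)`; every projection is absorbed by `h`, and only the
  -- sign remains.
  have hBW : secondFundamentalForm (F := F) f (leviCivita Z (hf.ξ i))
      (curvature X (hf.ξ i) (hf.ξ i)) x = -secondFundamentalForm f X Z x := by
    obtain ⟨L, hL⟩ := exists_linearMap_secondFundamentalForm hf.smooth (hZ.mdifferentiableAt x)
    rw [hf.leviCivita_ξ hS i hZ, hf.secondFundamentalForm_horizontal hS hW,
      secondFundamentalForm_symm hf.smooth (hZ.mdifferentiableAt x) (hW.mdifferentiableAt x),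
      ← hf.secondFundamentalForm_horizontal hS hZ X x,
      ← hf.secondFundamentalForm_horizontal hS hZ (fun y ↦ hf.horizontal y (X y)) x, hL, hL,
      hf.curvature_ξ_ξ hS i hX, map_neg]
  have hcov1 : covSecondFundamentalForm (F := F) f Z (curvature X (hf.ξ i) (hf.ξ i)) (hf.ξ i) x
      = secondFundamentalForm f X Z x := by
    rw [covSecondFundamentalForm, hf.secondFundamentalForm_ξ hS, hf.secondFundamentalForm_ξ hS,
      normalConnection_zero hf.smooth,
      secondFundamentalForm_symm hf.smooth (hW.mdifferentiableAt x) (hB.mdifferentiableAt x), hBW]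
    simp
  have hcov2 : covSecondFundamentalForm (F := F) f Z (hf.ξ i) (curvature X (hf.ξ i) (hf.ξ i)) x
      = secondFundamentalForm f X Z x := by
    rw [covSecondFundamentalForm, hf.secondFundamentalForm_ξ_left hS i hW,
      hf.secondFundamentalForm_ξ_left hS i (hZ.leviCivita hW), normalConnection_zero hf.smooth,
      hBW]
    simp
  -- Of the four terms, those with `ξ` in both slots of `h` vanish, and the other two each equal
  -- `-h(X, Z)`.
  have key := h X (hf.ξ i) Z (hf.ξ i) (hf.ξ i) hX hξ hZ hξ hξ x
  rw [curvatureActionOnCovSFF, hcov Z hZ, normalCurvature_zero hf.smooth,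
    hcov _ (hX.curvature hξ hZ), hcov1, hcov2] at key
  simpa [sub_eq_add_neg, ← neg_add, ← two_smul ℝ] using key

end IsInvariantSubmanifold

end GenKenmotsu

end

theorem mainTheorem2 {n s m : ℕ}
    {Mbar : Type*} [TopologicalSpace Mbar] [T2Space Mbar] [SecondCountableTopology Mbar]
    [ChartedSpace (EuclideanSpace ℝ (Fin (2 * n + s))) Mbar]
    [IsManifold (𝓡 (2 * n + s)) ∞ Mbar]
    [RiemannianBundle (fun x : Mbar ↦ TangentSpace (𝓡 (2 * n + s)) x)]
    [IsContMDiffRiemannianBundle (𝓡 (2 * n + s)) ∞ (EuclideanSpace ℝ (Fin (2 * n + s)))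
      (fun x : Mbar ↦ TangentSpace (𝓡 (2 * n + s)) x)]
    {M : Type*} [TopologicalSpace M] [T2Space M] [SecondCountableTopology M]
    [ChartedSpace (EuclideanSpace ℝ (Fin m)) M] [IsManifold (𝓡 m) ∞ M]
    [RiemannianBundle (fun x : M ↦ TangentSpace (𝓡 m) x)]
    [IsContMDiffRiemannianBundle (𝓡 m) ∞ (EuclideanSpace ℝ (Fin m))
      (fun x : M ↦ TangentSpace (𝓡 m) x)]
    (S : GenKenmotsu.MetricFStructure (EuclideanSpace ℝ (Fin (2 * n + s))) Mbar s)
    (hS : S.IsGeneralizedKenmotsu n)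
    (f : M → Mbar) (hf : GenKenmotsu.IsInvariantSubmanifold (EuclideanSpace ℝ (Fin m)) S f) :
    GenKenmotsu.IsTwoSemiparallel (EuclideanSpace ℝ (Fin m))
        (EuclideanSpace ℝ (Fin (2 * n + s))) f ↔
      GenKenmotsu.IsTotallyGeodesic (EuclideanSpace ℝ (Fin m))
        (EuclideanSpace ℝ (Fin (2 * n + s))) f := by
  exact ⟨fun h ↦ hf.isTotallyGeodesic_of_isTwoSemiparallel hS h,
    fun h ↦ h.isTwoSemiparallel hf.smooth⟩
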